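/- Let $G$ be a locally compact second countable group equipped with a proper left-invariant metric $d$ that generates its topology, and fix a left Haar measure $\mu$ on $G$. Let $Z\subseteq G$ be a uniformly locally finite metric lattice in $(G,d)$; that is, there is $\delta>0$ with $d(z,w)>\delta$ for all distinct $z,w\in Z$, there is $R>0$ such that every point of $G$ is at distance at most $R$ from some point of $Z$, and $\sup_{z\in Z}|\{w\in Z: d(z,w)\le S\}|<\infty$ for every $S>0$. Let $C^*_u(Z)\subseteq B(\ell^2(Z))$ be the uniform Roe algebra of $Z$, i.e. the operator norm closure of the $*$-algebra of all bounded operators $a=[a_{x,y}]_{x,y\in Z}$ of finite propagation ($\sup\{d(x,y): a_{x,y}\ne 0\}<\infty$). Let $C_b^{ru}(G)$ be the C*-algebra of bounded continuous functions $f:G\to\mathbb{C}$ such that $\sup_{x\in G}|f(xg)-f(x)|\to 0$ as $g\to e$, and let $G$ act on $C_b^{ru}(G)$ and on its ideal $C_0(G)$ by right translation, $(R_gf)(x)=f(xg)$. Let $C_0(G)\rtimes_{R,r}G\subseteq C_b^{ru}(G)\rtimes_{R,r}G$ denote the corresponding reduced crossed products. Then there exist a faithful (injective) $*$-homomorphism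 $$\Phi: C_u^*(Z)\to C_b^{ru}(G)\rtimes_{R,r}G$$ and a contractive completely positive linear map $$E: C_b^{ru}(G)\rtimes_{R,r}G\to C_u^*(Z)$$ such that (1) $E\circ\Phi=\mathrm{Id}_{C_u^*(Z)}$; (2) for every $T\in C_u^*(Z)$, the operator $T$ is compact on $\ell^2(Z)$ if and only if $\Phi(T)\in C_0(G)\rtimes_{R,r}G$. -/

import Mathlib

open MeasureTheory Filter Topology
open scoped ENNReal BoundedContinuousFunction ZeroAtInfty CompactlySupported CStarAlgebra

noncomputable section

set_option linter.unusedSectionVars false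

namespace RoeCrossed

/-! ### Metric spaces, lattices and uniform Roe algebras -/

section Coarse

variable {X : Type*} [MetricSpace X]

/-- Closed balls of a given radius have uniformly bounded cardinality. -/
def UniformlyLocallyFinite (X : Type*) [MetricSpace X] : Prop :=
  ∀ S : ℝ, 0 < S → ∃ N : ℕ, ∀ z : X, (Metric.closedBall z S).encard ≤ N

/-- Distinct points are uniformly separated. -/
def UniformlyDiscrete (X : Type*) [MetricSpace X] : Prop :=
  ∃ δ : ℝ, 0 < δ ∧ ∀ z w : X, z ≠ w → δ < dist z w

/-- A metric lattice in `X` : a uniformly discrete subspace, some closed neighbourhood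
of which is all of `X`. -/
def IsMetricLattice (Z : Set X) : Prop :=
  UniformlyDiscrete Z ∧ ∃ R : ℝ, 0 < R ∧ (⋃ z ∈ Z, Metric.closedBall z R) = Set.univ

/-- The Hilbert space `ℓ²(X)`. -/
abbrev Ell2 (X : Type*) : Type _ := lp (fun _ : X => ℂ) 2

open Classical in
/-- The basis vector `δ_x` of `ℓ²(X)`. -/
def basisVec {X : Type*} (x : X) : Ell2 X := lp.single 2 x (1 : ℂ)

/-- The matrix coefficient `a_{x,y} = ⟨a δ_y, δ_x⟩` (linear in the vector `a δ_y`). -/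
def entry {X : Type*} (a : Ell2 X →L[ℂ] Ell2 X) (x y : X) : ℂ :=
  inner ℂ (basisVec x) (a (basisVec y))

/-- The propagation of `a` is at most `R`. -/
def PropagationLE (a : Ell2 X →L[ℂ] Ell2 X) (R : ℝ) : Prop :=
  ∀ x y : X, entry a x y ≠ 0 → dist x y ≤ R

theorem entry_eq {X : Type*} (a : Ell2 X →L[ℂ] Ell2 X) (x y : X) :
    entry a x y = a (basisVec y) x := by
  classical
  unfold entry
  conv_lhs => rw [basisVec]
  rw [lp.inner_single_left]
  simp

theorem entry_star {X : Type*} (a : Ell2 X →L[ℂ] Ell2 X) (x y : X) :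
    entry (star a) x y = (starRingEnd ℂ) (entry a y x) := by
  unfold entry
  rw [ContinuousLinearMap.star_eq_adjoint, ContinuousLinearMap.adjoint_inner_right,
    inner_conj_symm]

theorem entry_mul_ne_zero {X : Type*} (a b : Ell2 X →L[ℂ] Ell2 X) (x z : X)
    (h : entry (a * b) x z ≠ 0) : ∃ y, entry a x y ≠ 0 ∧ entry b y z ≠ 0 := by
  classical
  by_contra hcon
  push Not at hcon
  apply h
  let φ : Ell2 X →L[ℂ] ℂ := (innerSL ℂ (basisVec x)).comp a
  have key : ∀ v : Ell2 X, (∀ y, entry a x y ≠ 0 → v y = 0) → φ v = 0 := by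
    intro v hv
    have hs' := φ.hasSum (lp.hasSum_single (p := 2) (by simp) v)
    have h0 : ∀ y, φ (lp.single 2 y (v y)) = 0 := by
      intro y
      have h1 : (lp.single 2 y (v y) : Ell2 X) = (v y) • (basisVec y : Ell2 X) := by
        have := lp.single_smul (E := fun _ : X => ℂ) (𝕜 := ℂ) 2 y (v y) (1 : ℂ)
        rw [smul_eq_mul, mul_one] at this
        rw [this, basisVec]
      rw [h1, map_smul]
      change v y • entry a x y = 0
      by_cases ha : entry a x y = 0
      · rw [ha, smul_zero]
      · rw [hv y ha, zero_smul]
    have h2 : HasSum (fun y => φ (lp.single 2 y (v y))) 0 := by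
      rw [funext h0]
      exact hasSum_zero
    exact hs'.unique h2
  exact key (b (basisVec z)) fun y hy => by rw [← entry_eq]; exact hcon y hy

/-- The `*`-algebra of all bounded operators of finite propagation on `ℓ²(X)`. -/
def finitePropagation (X : Type*) [MetricSpace X] : StarSubalgebra ℂ (Ell2 X →L[ℂ] Ell2 X) where
  carrier := {a | ∃ R : ℝ, 0 < R ∧ PropagationLE a R}
  mul_mem' := by
    rintro a b ⟨R, hR, ha⟩ ⟨S, hS, hb⟩
    refine ⟨R + S, by positivity, fun x z h => ?_⟩
    obtain ⟨y, h1, h2⟩ := entry_mul_ne_zero a b x z h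
    exact (dist_triangle x y z).trans (add_le_add (ha _ _ h1) (hb _ _ h2))
  add_mem' := by
    rintro a b ⟨R, hR, ha⟩ ⟨S, hS, hb⟩
    refine ⟨R + S, by positivity, fun x z h => ?_⟩
    have : entry (a + b) x z = entry a x z + entry b x z := by
      simp [entry]
    rw [this] at h
    by_cases h1 : entry a x z = 0
    · have := hb x z (by simpa [h1] using h)
      linarith
    · have := ha x z h1
      linarith
  algebraMap_mem' := by
    classical
    intro r
    refine ⟨1, one_pos, fun x y h => ?_⟩
    by_cases hxy : x = y
    · simp [hxy]
    · exfalso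
      apply h
      rw [entry_eq, Algebra.algebraMap_eq_smul_one]
      simp [basisVec, hxy]
  star_mem' := by
    rintro a ⟨R, hR, ha⟩
    refine ⟨R, hR, fun x y h => ?_⟩
    rw [entry_star] at h
    rw [dist_comm]
    exact ha y x (by simpa using h)

/-- The uniform Roe algebra `C*_u(X)` : the operator norm closure of the operators of
finite propagation. -/
def uniformRoeAlgebra (X : Type*) [MetricSpace X] : StarSubalgebra ℂ (Ell2 X →L[ℂ] Ell2 X) :=
  (finitePropagation X).topologicalClosure

instance (X : Type*) [MetricSpace X] :
    IsClosed (uniformRoeAlgebra X : Set (Ell2 X →L[ℂ] Ell2 X)) :=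
  (finitePropagation X).isClosed_topologicalClosure

end Coarse

/-! ### Completely positive contractive maps -/

/-- Contractive completely positive (c.c.p.) linear maps between C*-algebras, the order being the
usual one (positive means self-adjoint with non-negative spectrum). -/
def IsCCP {A B : Type*} [NonUnitalCStarAlgebra A] [NonUnitalCStarAlgebra B]
    (φ : A →ₗ[ℂ] B) : Prop :=
  letI := CStarAlgebra.spectralOrder A
  letI := CStarAlgebra.spectralOrder B
  haveI := CStarAlgebra.spectralOrderedRing A
  haveI := CStarAlgebra.spectralOrderedRing B
  (∃ ψ : A →CP B, ψ.toLinearMap = φ) ∧ ∀ a, ‖φ a‖ ≤ ‖a‖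

/-! ### Reduced crossed products -/

/-- A strongly continuous action of `G` on a C*-algebra `A` by `*`-automorphisms (the values are
automatically invertible, since `G` is a group). -/
structure CStarAction (G A : Type*) [Group G] [TopologicalSpace G] [NonUnitalCStarAlgebra A] where
  act : G →* (A →⋆ₙₐ[ℂ] A)
  continuous_act : ∀ a : A, Continuous fun g => act g a

section Lp

variable {G : Type*} [Group G] [TopologicalSpace G] [IsTopologicalGroup G] [T2Space G]
  [LocallyCompactSpace G] [SecondCountableTopology G] [MeasurableSpace G] [BorelSpace G]

/-- The Hilbert space `L²(G, H)`. -/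
abbrev L2 (μ : Measure G) (H : Type*) [NormedAddCommGroup H] : Type _ := Lp H 2 μ

variable (μ : Measure G)
variable {E H : Type*} [NormedAddCommGroup E] [NormedSpace ℂ E]
  [NormedAddCommGroup H] [InnerProductSpace ℂ H]

theorem memLp_top_bcf (F : G →ᵇ E) : MemLp F ∞ μ :=
  memLp_top_of_bound F.continuous.aestronglyMeasurable ‖F‖
    (Eventually.of_forall F.norm_coe_le_norm)

/-- The operator `(F ξ)(t) = B (F t) (ξ t)` on `L²(G, H)`. -/
def pointwiseOp (B : E →L[ℂ] H →L[ℂ] H) (F : G →ᵇ E) : L2 μ H →L[ℂ] L2 μ H :=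
  B.holderL μ ∞ 2 2 (memLp_top_bcf μ F).toLp

variable {μ} in
theorem pointwiseOp_coe (B : E →L[ℂ] H →L[ℂ] H) (F : G →ᵇ E) (ξ : L2 μ H) :
    pointwiseOp μ B F ξ =ᵐ[μ] fun t => B (F t) (ξ t) := by
  have h := B.coeFn_holder (r := 2) (memLp_top_bcf μ F).toLp ξ
  filter_upwards [h, (memLp_top_bcf μ F).coeFn_toLp] with t h1 h2
  rw [← h2]
  exact h1

theorem norm_pointwiseOp_le (B : E →L[ℂ] H →L[ℂ] H) (F : G →ᵇ E) :
    ‖pointwiseOp μ B F‖ ≤ ‖B‖ * ‖F‖ := by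
  have hF : ‖(memLp_top_bcf μ F).toLp‖ ≤ ‖F‖ := by
    rw [Lp.norm_toLp]
    refine ENNReal.toReal_le_of_le_ofReal (norm_nonneg _) ?_
    rw [eLpNorm_exponent_top]
    exact eLpNormEssSup_le_of_ae_bound (Eventually.of_forall F.norm_coe_le_norm)
  refine ContinuousLinearMap.opNorm_le_bound _ (by positivity) fun ξ => ?_
  refine (B.norm_holder_apply_apply_le (r := 2) (memLp_top_bcf μ F).toLp ξ).trans ?_
  gcongr

theorem pointwiseOp_sub (B : E →L[ℂ] H →L[ℂ] H) (F F' : G →ᵇ E) :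
    pointwiseOp μ B (F - F') = pointwiseOp μ B F - pointwiseOp μ B F' := by
  have h : (memLp_top_bcf μ (F - F')).toLp
      = (memLp_top_bcf μ F).toLp - (memLp_top_bcf μ F').toLp := rfl
  unfold pointwiseOp
  rw [h, map_sub]

/-- The multiplication representation `M` of `C_b(G)` on `L²(G)`, `(M(f) ξ)(x) = f(x) ξ(x)`. -/
def mulRep : (G →ᵇ ℂ) →⋆ₙₐ[ℂ] (L2 μ ℂ →L[ℂ] L2 μ ℂ) where
  toFun f := pointwiseOp μ (ContinuousLinearMap.mul ℂ ℂ) f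
  map_smul' c f := by
    ext ξ
    filter_upwards [pointwiseOp_coe (ContinuousLinearMap.mul ℂ ℂ) (c • f) ξ,
      pointwiseOp_coe (ContinuousLinearMap.mul ℂ ℂ) f ξ,
      Lp.coeFn_smul c (pointwiseOp μ (ContinuousLinearMap.mul ℂ ℂ) f ξ)] with t h1 h2 h3
    simp only [MonoidHom.id_apply, _root_.smul_apply]
    rw [h1, h3]
    simp [h2, mul_assoc]
  map_zero' := by
    ext ξ
    filter_upwards [pointwiseOp_coe (ContinuousLinearMap.mul ℂ ℂ) (0 : G →ᵇ ℂ) ξ,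
      Lp.coeFn_zero ℂ 2 μ] with t h1 h2
    simp only [_root_.zero_apply]
    rw [h1, h2]
    simp
  map_add' f g := by
    ext ξ
    filter_upwards [pointwiseOp_coe (ContinuousLinearMap.mul ℂ ℂ) (f + g) ξ,
      pointwiseOp_coe (ContinuousLinearMap.mul ℂ ℂ) f ξ,
      pointwiseOp_coe (ContinuousLinearMap.mul ℂ ℂ) g ξ,
      Lp.coeFn_add (pointwiseOp μ (ContinuousLinearMap.mul ℂ ℂ) f ξ)
        (pointwiseOp μ (ContinuousLinearMap.mul ℂ ℂ) g ξ)] with t h1 h2 h3 h4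
    simp only [_root_.add_apply]
    rw [h1, h4]
    simp [h2, h3]
  map_mul' f g := by
    ext ξ
    filter_upwards [pointwiseOp_coe (ContinuousLinearMap.mul ℂ ℂ) (f * g) ξ,
      pointwiseOp_coe (ContinuousLinearMap.mul ℂ ℂ) f
        (pointwiseOp μ (ContinuousLinearMap.mul ℂ ℂ) g ξ),
      pointwiseOp_coe (ContinuousLinearMap.mul ℂ ℂ) g ξ] with t h1 h2 h3
    simp only [_root_.mul_apply_eq_comp]
    rw [h1, h2, h3]
    simp [mul_assoc]
  map_star' f := by
    rw [ContinuousLinearMap.star_eq_adjoint, ContinuousLinearMap.eq_adjoint_iff]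
    intro ξ η
    rw [MeasureTheory.L2.inner_def, MeasureTheory.L2.inner_def]
    apply integral_congr_ae
    filter_upwards [pointwiseOp_coe (ContinuousLinearMap.mul ℂ ℂ) (star f) ξ,
      pointwiseOp_coe (ContinuousLinearMap.mul ℂ ℂ) f η] with t h1 h2
    rw [h1, h2]
    simp
    ring

theorem mulRep_coe (f : G →ᵇ ℂ) (ξ : L2 μ ℂ) : mulRep μ f ξ =ᵐ[μ] fun x => f x * ξ x :=
  pointwiseOp_coe (ContinuousLinearMap.mul ℂ ℂ) f ξ

/-- The left regular representation `λ_s ⊗ 1` of `G` on `L²(G, H)`,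
`((λ_s ⊗ 1) ξ)(t) = ξ(s⁻¹ t)`. -/
def leftReg [μ.IsMulLeftInvariant] (H : Type*) [NormedAddCommGroup H] [InnerProductSpace ℂ H]
    (s : G) : L2 μ H →L[ℂ] L2 μ H :=
  (Lp.compMeasurePreservingₗᵢ ℂ (fun t : G => s⁻¹ * t)
    (measurePreserving_mul_left μ s⁻¹)).toContinuousLinearMap

theorem leftReg_coe [μ.IsMulLeftInvariant] (s : G) (ξ : L2 μ H) :
    leftReg μ H s ξ =ᵐ[μ] fun t => ξ (s⁻¹ * t) :=
  Lp.coeFn_compMeasurePreserving ξ (measurePreserving_mul_left μ s⁻¹)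

theorem norm_leftReg_apply [μ.IsMulLeftInvariant] (s : G) (ξ : L2 μ H) :
    ‖leftReg μ H s ξ‖ = ‖ξ‖ :=
  Lp.norm_compMeasurePreserving ξ (measurePreserving_mul_left μ s⁻¹)

theorem continuous_leftReg [μ.IsHaarMeasure] (ξ : L2 μ H) :
    Continuous fun s : G => leftReg μ H s ξ := by
  let g : C(G, C(G, G)) :=
    (ContinuousMap.mk (fun a : G × G => a.1⁻¹ * a.2) (by fun_prop)).curry
  exact Continuous.compMeasurePreservingLp (continuous_const (y := ξ)) g.continuous
    (fun s => measurePreserving_mul_left μ s⁻¹) (by simp)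

variable {A : Type*} [NonUnitalCStarAlgebra A] [CompleteSpace H]

/-- The function `t ↦ π(α_{t⁻¹}(a))`. -/
def twisted (α : CStarAction G A) (π : A →⋆ₙₐ[ℂ] (H →L[ℂ] H)) (a : A) : G →ᵇ (H →L[ℂ] H) :=
  BoundedContinuousFunction.ofNormedAddCommGroup (fun t => π (α.act t⁻¹ a))
    ((map_continuous π).comp ((α.continuous_act a).comp continuous_inv)) ‖a‖
    (fun t => (NonUnitalStarAlgHom.norm_apply_le π _).trans
      (NonUnitalStarAlgHom.norm_apply_le (α.act t⁻¹) a))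

/-- The representation `π_α` of `A` on `L²(G, H)` : `(π_α(a) ξ)(t) = π(α_{t⁻¹}(a)) ξ(t)`. -/
def inducedRep (α : CStarAction G A) (π : A →⋆ₙₐ[ℂ] (H →L[ℂ] H)) (a : A) :
    L2 μ H →L[ℂ] L2 μ H :=
  pointwiseOp μ (ContinuousLinearMap.id ℂ (H →L[ℂ] H)) (twisted α π a)

theorem inducedRep_coe (α : CStarAction G A) (π : A →⋆ₙₐ[ℂ] (H →L[ℂ] H)) (a : A) (ξ : L2 μ H) :
    inducedRep μ α π a ξ =ᵐ[μ] fun t => π (α.act t⁻¹ a) (ξ t) :=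
  pointwiseOp_coe (ContinuousLinearMap.id ℂ (H →L[ℂ] H)) (twisted α π a) ξ

theorem norm_inducedRep_le (α : CStarAction G A) (π : A →⋆ₙₐ[ℂ] (H →L[ℂ] H)) (a : A) :
    ‖inducedRep μ α π a‖ ≤ ‖a‖ := by
  refine (norm_pointwiseOp_le _ _ _).trans ?_
  calc _ ≤ 1 * ‖a‖ := by
        gcongr
        · exact ContinuousLinearMap.norm_id_le
        · exact BoundedContinuousFunction.norm_ofNormedAddCommGroup_le _ (norm_nonneg _) _
    _ = ‖a‖ := one_mul _

theorem inducedRep_sub (α : CStarAction G A) (π : A →⋆ₙₐ[ℂ] (H →L[ℂ] H)) (a b : A) :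
    inducedRep μ α π (a - b) = inducedRep μ α π a - inducedRep μ α π b := by
  unfold inducedRep
  rw [← pointwiseOp_sub]
  congr 1
  ext t : 1
  simp [twisted]

theorem continuous_inducedRep (α : CStarAction G A) (π : A →⋆ₙₐ[ℂ] (H →L[ℂ] H)) :
    Continuous (inducedRep μ α π) := by
  have : LipschitzWith 1 (inducedRep μ α π) := by
    refine LipschitzWith.of_dist_le_mul fun a b => ?_
    rw [dist_eq_norm, dist_eq_norm, ← inducedRep_sub]
    simpa using norm_inducedRep_le μ α π (a - b)
  exact this.continuous

theorem integrable_regular [μ.IsHaarMeasure] (α : CStarAction G A) (π : A →⋆ₙₐ[ℂ] (H →L[ℂ] H))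
    (f : C_c(G, A)) (ξ : L2 μ H) :
    Integrable (fun s => inducedRep μ α π (f s) (leftReg μ H s ξ)) μ := by
  refine Continuous.integrable_of_hasCompactSupport ?_ ?_
  · exact ((continuous_inducedRep μ α π).comp (map_continuous f)).clm_apply
      (continuous_leftReg μ ξ)
  · refine f.hasCompactSupport.mono ?_
    intro s hs
    contrapose! hs
    have h0 : f s = 0 := by simpa using hs
    have : inducedRep μ α π 0 = 0 := by simpa using inducedRep_sub μ α π 0 0
    simp [h0, this]

/-- The integrated form `(π_α ⋊ (λ ⊗ 1))(f) = ∫ π_α(f(s)) (λ_s ⊗ 1) dμ(s)` of the regular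
representation of `C_c(G, A)` on `L²(G, H)`. The integral converges strongly. -/
def regularRep [μ.IsHaarMeasure] (α : CStarAction G A) (π : A →⋆ₙₐ[ℂ] (H →L[ℂ] H))
    (f : C_c(G, A)) : L2 μ H →L[ℂ] L2 μ H :=
  LinearMap.mkContinuous
    { toFun := fun ξ => ∫ s, inducedRep μ α π (f s) (leftReg μ H s ξ) ∂μ
      map_add' := fun ξ η => by
        simp only [map_add]
        exact integral_add (integrable_regular μ α π f ξ) (integrable_regular μ α π f η)
      map_smul' := fun c ξ => by
        simp only [map_smul, RingHom.id_apply]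
        exact integral_smul c _ }
    (∫ s, ‖f s‖ ∂μ) (fun ξ => by
      have hf : Integrable (fun s => ‖f s‖) μ :=
        ((map_continuous f).integrable_of_hasCompactSupport f.hasCompactSupport).norm
      rw [← integral_mul_const]
      refine norm_integral_le_of_norm_le (hf.mul_const _) (Eventually.of_forall fun s => ?_)
      refine (ContinuousLinearMap.le_opNorm _ _).trans ?_
      rw [norm_leftReg_apply]
      gcongr
      exact norm_inducedRep_le μ α π (f s))

theorem regularRep_apply [μ.IsHaarMeasure] (α : CStarAction G A) (π : A →⋆ₙₐ[ℂ] (H →L[ℂ] H))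
    (f : C_c(G, A)) (ξ : L2 μ H) :
    regularRep μ α π f ξ = ∫ s, inducedRep μ α π (f s) (leftReg μ H s ξ) ∂μ := rfl

/-- The reduced crossed product `A ⋊_{α,r} G`, realised on `L²(G, H)` through the regular
representation of `C_c(G, A)` induced by a faithful representation `π` of `A` on `H`.
The image of `C_c(G, A)` is a `*`-subalgebra (for the convolution product), so the C*-algebra
that it generates is its norm closure, that is, the completion of `C_c(G, A)` for the reduced
norm. -/
def reducedCrossedProduct [μ.IsHaarMeasure] (α : CStarAction G A)
    (π : A →⋆ₙₐ[ℂ] (H →L[ℂ] H)) (_hπ : Function.Injective π) :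
    NonUnitalStarSubalgebra ℂ (L2 μ H →L[ℂ] L2 μ H) :=
  (NonUnitalStarAlgebra.adjoin ℂ (Set.range (regularRep μ α π))).topologicalClosure

instance [μ.IsHaarMeasure] (α : CStarAction G A)
    (π : A →⋆ₙₐ[ℂ] (H →L[ℂ] H)) (hπ : Function.Injective π) :
    IsClosed (reducedCrossedProduct μ α π hπ : Set (L2 μ H →L[ℂ] L2 μ H)) :=
  NonUnitalStarSubalgebra.isClosed_topologicalClosure _

theorem mulRep_injective [μ.IsHaarMeasure] : Function.Injective (mulRep μ (G := G)) := by
  intro f g hfg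
  obtain ⟨K, hK⟩ : ∃ K : ℕ → Set G, (∀ n, IsCompact (K n)) ∧ ⋃ n, K n = Set.univ :=
    ⟨compactCovering G, isCompact_compactCovering G, iUnion_compactCovering G⟩
  have hae : ∀ᵐ x ∂μ, ∀ n, x ∈ K n → f x = g x := by
    rw [ae_all_iff]
    intro n
    have hfin : μ (toMeasurable μ (K n)) ≠ ∞ := by
      rw [measure_toMeasurable]; exact (hK.1 n).measure_lt_top.ne
    let ξ : L2 μ ℂ := indicatorConstLp 2 (measurableSet_toMeasurable μ (K n)) hfin (1 : ℂ)
    have h : mulRep μ f ξ = mulRep μ g ξ := by rw [hfg]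
    have h1 := mulRep_coe μ f ξ
    have h2 := mulRep_coe μ g ξ
    rw [h] at h1
    filter_upwards [h1, h2, indicatorConstLp_coeFn_mem
      (p := 2) (hs := measurableSet_toMeasurable μ (K n)) (hμs := hfin) (c := (1 : ℂ))]
      with x h1 h2 h3 hx
    have h4 : ξ x = 1 := h3 (subset_toMeasurable _ _ hx)
    rw [h1, h4] at h2
    simpa using h2
  have hae' : f =ᵐ[μ] g := by
    filter_upwards [hae] with x hx
    obtain ⟨n, hn⟩ := Set.mem_iUnion.1 (hK.2 ▸ Set.mem_univ x)
    exact hx n hn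
  exact DFunLike.coe_injective ((f.continuous.ae_eq_iff_eq μ g.continuous).1 hae')

end Lp

/-! ### Right translation on function algebras -/

section Translation

variable {G : Type*} [Group G] [TopologicalSpace G] [IsTopologicalGroup G]

/-- Right translation `(R_g f)(x) = f(xg)` on `C_b(G)`. -/
def rightTranslate (g : G) : (G →ᵇ ℂ) →⋆ₙₐ[ℂ] (G →ᵇ ℂ) where
  toFun f := f.compContinuous ⟨fun x => x * g, by fun_prop⟩
  map_smul' _ _ := rfl
  map_zero' := rfl
  map_add' _ _ := rfl
  map_mul' _ _ := rfl
  map_star' _ := rfl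

/-- The C*-algebra `C_b^{ru}(G)` of bounded right uniformly continuous functions on `G` : for every
`ε > 0`, `sup_x |f(xg) - f(x)| ≤ ε` for all `g` in a neighbourhood of the identity. -/
def Cbru (G : Type*) [Group G] [TopologicalSpace G] [IsTopologicalGroup G] :
    StarSubalgebra ℂ (G →ᵇ ℂ) where
  carrier := {f | ∀ ε : ℝ, 0 < ε → ∀ᶠ g in 𝓝 (1 : G), ∀ x : G, ‖f (x * g) - f x‖ ≤ ε}
  mul_mem' := by
    intro f f' hf hf' ε hε
    have hC : 0 < ‖f‖ + ‖f'‖ + 1 := by positivity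
    filter_upwards [hf (ε / (‖f‖ + ‖f'‖ + 1)) (by positivity),
      hf' (ε / (‖f‖ + ‖f'‖ + 1)) (by positivity)] with g h h' x
    have e : (f * f') (x * g) - (f * f') x
        = (f (x * g) - f x) * f' (x * g) + f x * (f' (x * g) - f' x) := by
      simp only [BoundedContinuousFunction.mul_apply]
      ring
    rw [e]
    calc _ ≤ ‖f (x * g) - f x‖ * ‖f' (x * g)‖ + ‖f x‖ * ‖f' (x * g) - f' x‖ := by
          refine (norm_add_le _ _).trans ?_
          rw [norm_mul, norm_mul]
      _ ≤ (ε / (‖f‖ + ‖f'‖ + 1)) * ‖f'‖ + ‖f‖ * (ε / (‖f‖ + ‖f'‖ + 1)) := by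
          gcongr
          · exact h x
          · exact f'.norm_coe_le_norm _
          · exact f.norm_coe_le_norm _
          · exact h' x
      _ = ε * ((‖f‖ + ‖f'‖) / (‖f‖ + ‖f'‖ + 1)) := by ring
      _ ≤ ε * 1 := by
          gcongr
          rw [div_le_one hC]
          linarith
      _ = ε := mul_one _
  add_mem' := by
    intro f f' hf hf' ε hε
    filter_upwards [hf (ε / 2) (by positivity), hf' (ε / 2) (by positivity)] with g h h' x
    have e : (f + f') (x * g) - (f + f') x = (f (x * g) - f x) + (f' (x * g) - f' x) := by
      simp only [BoundedContinuousFunction.add_apply]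
      ring
    rw [e]
    refine (norm_add_le _ _).trans ?_
    linarith [h x, h' x]
  algebraMap_mem' := by
    intro r ε hε
    refine Eventually.of_forall fun g x => ?_
    simp [Algebra.algebraMap_eq_smul_one, hε.le]
  star_mem' := by
    intro f hf ε hε
    filter_upwards [hf ε hε] with g h x
    have e : (star f) (x * g) - (star f) x = star (f (x * g) - f x) := by simp
    rw [e, norm_star]
    exact h x

theorem mem_Cbru_iff (f : G →ᵇ ℂ) : f ∈ Cbru G ↔
    ∀ ε : ℝ, 0 < ε → ∀ᶠ g in 𝓝 (1 : G), ∀ x : G, ‖f (x * g) - f x‖ ≤ ε := Iff.rfl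

instance : IsClosed (Cbru G : Set (G →ᵇ ℂ)) := by
  rw [← isSeqClosed_iff_isClosed]
  intro u f hu hf ε hε
  obtain ⟨n, hn⟩ := ((tendsto_iff_dist_tendsto_zero.1 hf).eventually
    (gt_mem_nhds (show (0 : ℝ) < ε / 3 by positivity))).exists
  filter_upwards [hu n (ε / 3) (by positivity)] with g h x
  have h1 := (u n).dist_coe_le_dist (g := f) (x * g)
  have h2 := (u n).dist_coe_le_dist (g := f) x
  have h3 := h x
  rw [← dist_eq_norm] at h3 ⊢
  have h4 := dist_triangle4 (f (x * g)) (u n (x * g)) (u n x) (f x)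
  rw [dist_comm (f (x * g)) (u n (x * g))] at h4
  linarith

theorem rightTranslate_mem (g : G) {f : G →ᵇ ℂ} (hf : f ∈ Cbru G) :
    rightTranslate g f ∈ Cbru G := by
  intro ε hε
  have ht : Tendsto (fun k : G => g⁻¹ * k * g) (𝓝 1) (𝓝 1) := by
    have : Continuous (fun k : G => g⁻¹ * k * g) := by fun_prop
    simpa using this.tendsto 1
  filter_upwards [ht.eventually (hf ε hε)] with k hk x
  have := hk (x * g)
  have e : x * g * (g⁻¹ * k * g) = x * k * g := by group
  rw [e] at this
  exact this

theorem continuous_rightTranslate {f : G →ᵇ ℂ} (hf : f ∈ Cbru G) :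
    Continuous fun g : G => rightTranslate g f := by
  rw [continuous_iff_continuousAt]
  intro g
  rw [ContinuousAt, Metric.tendsto_nhds]
  intro ε hε
  have ht : Tendsto (fun k : G => g⁻¹ * k) (𝓝 g) (𝓝 1) := by
    have : Continuous (fun k : G => g⁻¹ * k) := by fun_prop
    simpa using this.tendsto g
  filter_upwards [ht.eventually (hf (ε / 2) (by positivity))] with k hk
  refine lt_of_le_of_lt ((BoundedContinuousFunction.dist_le (by positivity)).2 fun x => ?_)
    (half_lt_self hε)
  have := hk (x * g)
  have e : x * g * (g⁻¹ * k) = x * k := by group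
  rw [e] at this
  rw [dist_eq_norm]
  exact this

/-- The action `R` of `G` on `C_b^{ru}(G)` by right translation. -/
def actionCbru (G : Type*) [Group G] [TopologicalSpace G] [IsTopologicalGroup G] :
    CStarAction G (Cbru G) where
  act :=
    { toFun := fun g =>
        { toFun := fun f => ⟨rightTranslate g f, rightTranslate_mem g f.2⟩
          map_smul' := fun _ _ => rfl
          map_zero' := rfl
          map_add' := fun _ _ => rfl
          map_mul' := fun _ _ => rfl
          map_star' := fun _ => rfl }
      map_one' := by
        ext f x
        exact congrArg (f : G →ᵇ ℂ) (mul_one x)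
      map_mul' := fun g h => by
        ext f x
        exact congrArg (f : G →ᵇ ℂ) (mul_assoc x g h).symm }
  continuous_act := fun f => (continuous_rightTranslate f.2).subtype_mk _

/-- The inclusion of `C_0(G)` into `C_b(G)`. -/
def inclC0 (G : Type*) [TopologicalSpace G] : C₀(G, ℂ) →⋆ₙₐ[ℂ] (G →ᵇ ℂ) where
  toFun f := f.toBCF
  map_smul' _ _ := rfl
  map_zero' := rfl
  map_add' _ _ := rfl
  map_mul' _ _ := rfl
  map_star' _ := rfl

theorem inclC0_mem (f : C₀(G, ℂ)) : inclC0 G f ∈ Cbru G := by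
  intro ε hε
  let := IsTopologicalGroup.leftUniformSpace G
  have hu : UniformContinuous f := ZeroAtInftyContinuousMap.uniformContinuous f
  have h1 := hu (Metric.dist_mem_uniformity hε)
  rw [mem_map, uniformity_eq_comap_nhds_one_left, mem_comap] at h1
  obtain ⟨t, ht, hsub⟩ := h1
  filter_upwards [ht] with g hg x
  have h2 : (x, x * g) ∈ (fun p : G × G => p.1⁻¹ * p.2) ⁻¹' t := by simpa using hg
  have h3 := hsub h2
  have h4 : dist (f x) (f (x * g)) < ε := h3
  rw [dist_comm, dist_eq_norm] at h4
  exact h4.le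

/-- The action `R` of `G` on `C_0(G)` by right translation, `(R_g f)(x) = f(xg)`. -/
def actionC0 (G : Type*) [Group G] [TopologicalSpace G] [IsTopologicalGroup G] :
    CStarAction G C₀(G, ℂ) where
  act :=
    { toFun := fun g =>
        { toFun := fun f => f.comp
            (⟨⟨fun x => x * g, by fun_prop⟩,
              (Homeomorph.mulRight g).isClosedEmbedding.tendsto_cocompact⟩ : CocompactMap G G)
          map_smul' := fun _ _ => rfl
          map_zero' := rfl
          map_add' := fun _ _ => rfl
          map_mul' := fun _ _ => rfl
          map_star' := fun _ => rfl }
      map_one' := by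
        ext f x
        exact congrArg f (mul_one x)
      map_mul' := fun g h => by
        ext f x
        exact congrArg f (mul_assoc x g h).symm }
  continuous_act := fun f => by
    rw [(ZeroAtInftyContinuousMap.isometry_toBCF (α := G) (β := ℂ)).isEmbedding.continuous_iff]
    exact continuous_rightTranslate (inclC0_mem f)

variable [T2Space G] [LocallyCompactSpace G] [SecondCountableTopology G] [MeasurableSpace G]
  [BorelSpace G] (μ : Measure G) [μ.IsHaarMeasure]

/-- The representation `M` of `C_b^{ru}(G)` on `L²(G)`. -/
def repCbru : Cbru G →⋆ₙₐ[ℂ] (L2 μ ℂ →L[ℂ] L2 μ ℂ) :=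
  (mulRep μ).comp (NonUnitalStarSubalgebraClass.subtype (Cbru G))

/-- The representation `M` of `C_0(G)` on `L²(G)`. -/
def repC0 : C₀(G, ℂ) →⋆ₙₐ[ℂ] (L2 μ ℂ →L[ℂ] L2 μ ℂ) :=
  (mulRep μ).comp (inclC0 G)

theorem repCbru_injective : Function.Injective (repCbru μ (G := G)) :=
  (mulRep_injective μ).comp Subtype.val_injective

theorem repC0_injective : Function.Injective (repC0 μ (G := G)) :=
  (mulRep_injective μ).comp (ZeroAtInftyContinuousMap.toBCF_injective G ℂ)

/-- `C_b^{ru}(G) ⋊_{R,r} G`, realised on `L²(G, L²(G))`. -/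
def crossedCbru : NonUnitalStarSubalgebra ℂ (L2 μ (L2 μ ℂ) →L[ℂ] L2 μ (L2 μ ℂ)) :=
  reducedCrossedProduct μ (actionCbru G) (repCbru μ) (repCbru_injective μ)

/-- `C_0(G) ⋊_{R,r} G`, realised on the same Hilbert space `L²(G, L²(G))`; it is contained in
`C_b^{ru}(G) ⋊_{R,r} G`. -/
def crossedC0 : NonUnitalStarSubalgebra ℂ (L2 μ (L2 μ ℂ) →L[ℂ] L2 μ (L2 μ ℂ)) :=
  reducedCrossedProduct μ (actionC0 G) (repC0 μ) (repC0_injective μ)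

theorem crossedC0_le_crossedCbru : crossedC0 μ ≤ crossedCbru μ := by
  refine NonUnitalStarSubalgebra.topologicalClosure_mono (NonUnitalStarAlgebra.adjoin_mono ?_)
  rintro _ ⟨f, rfl⟩
  let ι : C₀(G, ℂ) → Cbru G := fun a => ⟨inclC0 G a, inclC0_mem a⟩
  have hι : Continuous ι :=
    (ZeroAtInftyContinuousMap.isometry_toBCF (α := G) (β := ℂ)).continuous.subtype_mk _
  have hι0 : ι 0 = 0 := rfl
  refine ⟨⟨⟨fun s => ι (f s), hι.comp (map_continuous f)⟩,
    f.hasCompactSupport.comp_left hι0⟩, ?_⟩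
  rfl

instance : IsClosed (crossedCbru μ : Set (L2 μ (L2 μ ℂ) →L[ℂ] L2 μ (L2 μ ℂ))) :=
  inferInstanceAs (IsClosed (reducedCrossedProduct μ (actionCbru G) (repCbru μ)
    (repCbru_injective μ) : Set (L2 μ (L2 μ ℂ) →L[ℂ] L2 μ (L2 μ ℂ))))

end Translation

end RoeCrossed

end

open RoeCrossed

/-!
The idea is to spread the lattice out over the group. Let `r` be half of the separation constant of
`Z`, and let `φ_z`, for `z ∈ Z`, be the left translates of a bump function supported in the ball of
radius `r` around `z`; these functions are Lipschitz, hence in `C_b^{ru}(G)`, and they have disjoint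
supports. An operator `a` of finite propagation on `ℓ²(Z)` defines the kernel
`k_a(x, y) = ∑ a_{z,w} φ_z(x) φ_w(y)` on `G`, of finite propagation as well. With the modular
function `Δ`, the function `s ↦ Δ(s)^{1/2} k_a(·, · s)` is an element of `C_c(G, C_b^{ru}(G))`
(`kernCc`), and it is the candidate for `Φ(a)`.

To see that `a ↦ Φ(a)` is an isometric `*`-homomorphism, it is described on `L²(G, L²(G))` without
reference to convolution. For a suitably normalised function `h` the map
`η ↦ (t ↦ Δ(t)^{1/2} M(R_{t⁻¹} h) η)` is an isometry `J_h : L²(G) → L²(G, L²(G))`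
(`spreadIsometry`), and isometries of functions with disjoint supports have orthogonal ranges. So the
`J_z` defined by the `φ_z` assemble to an isometry `J : ℓ²(Z) ⊗ L²(G) → L²(G, L²(G))`, and
`T ↦ J (T ⊗ 1) J^*` (`transport`) is a faithful `*`-homomorphism on all bounded operators. The two
descriptions agree: Fubini's theorem shows that `J_h J_k^*` is, up to a constant, the image of
`s ↦ Δ(s)^{1/2} h · R_s k^*` under the regular representation (`regularRep_eq_spread_mul_adjoint`),
and by cutting off to bounded sets, where all sums are finite, this gives
`transport_eq_smul_regularRep`. Hence the transport maps the uniform Roe algebra into the crossed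
product. When `a` has only finitely many non-zero rows the coefficients of `Φ(a)` have compact
support, and a compact operator is the norm limit of its truncations to finitely many rows; this
yields `transport_mem_crossedC0`.

In the other direction, a unit vector `η` gives the isometry `W : ℓ²(Z) → L²(G, L²(G))`,
`δ_z ↦ J_z η`, and `E` is the compression `b ↦ W^* b W`. If `η` belongs to the orthonormal basis by
which the tensor product is realised, it is immediate that `E (Φ(T)) = T`. Compressions are
contractive and completely positive, because injective `*`-homomorphisms reflect positivity
(`isCCP_of_eq_compress`). Convolution elements have finite propagation with respect to the
multiplication operators by functions on `G`, and `J_z η` is localised near `z`, so `E` takes values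
in the uniform Roe algebra (`compress_mem_uniformRoeAlgebra`). Finally, elements of
`C_0(G) ⋊_{R,r} G` are limits of their products with cutoff functions of compact support
(`crossedC0_le_decaying`), and the compression of such a product only sees finitely many `δ_z`;
therefore `E` maps `C_0(G) ⋊_{R,r} G` to compact operators (`isCompactOperator_compress`).
-/

noncomputable section

set_option linter.unusedSectionVars false

namespace RoeCrossed

/-! ### Compressions of C*-algebras are completely positive -/

section CStar

/-- Injective `*`-homomorphisms reflect positivity: they carry the negative part of an element to
the negative part of its image. -/
theorem nonneg_of_map_nonneg {A B : Type*} [NonUnitalCStarAlgebra A] [PartialOrder A]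
    [StarOrderedRing A] [NonUnitalCStarAlgebra B] [PartialOrder B] [StarOrderedRing B]
    (f : A →⋆ₙₐ[ℂ] B) (hf : Function.Injective f) {a : A} (h : 0 ≤ f a) : 0 ≤ a := by
  have hfa : IsSelfAdjoint (f a) := IsSelfAdjoint.of_nonneg h
  have ha : IsSelfAdjoint a := by
    apply hf
    rw [map_star]
    exact hfa
  have h1 : f (a⁻) = (f a)⁻ := by
    rw [CFC.negPart_def, CFC.negPart_def]
    exact NonUnitalStarAlgHomClass.map_cfcₙ (S := ℂ) f _ a (hφ := map_continuous f)
  have h2 : (f a)⁻ = 0 := (CFC.negPart_eq_zero_iff (f a) hfa).2 h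
  rw [h2] at h1
  exact (CFC.negPart_eq_zero_iff a ha).1 (hf (by rw [h1, map_zero]))

variable {H K : Type*} [NormedAddCommGroup H] [InnerProductSpace ℂ H] [CompleteSpace H]
  [NormedAddCommGroup K] [InnerProductSpace ℂ K] [CompleteSpace K]

theorem adjoint_comp_isometry (W : H →ₗᵢ[ℂ] K) :
    (ContinuousLinearMap.adjoint W.toContinuousLinearMap) ∘L W.toContinuousLinearMap = 1 :=
  W.toContinuousLinearMap.norm_map_iff_adjoint_comp_self.1 W.norm_map

theorem adjoint_isometry_apply (W : H →ₗᵢ[ℂ] K) (v : H) :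
    ContinuousLinearMap.adjoint W.toContinuousLinearMap (W v) = v :=
  DFunLike.congr_fun (adjoint_comp_isometry W) v

/-- The `*`-homomorphism `T ↦ W T W*` defined by an isometry `W`. -/
def conjIsometry (W : H →ₗᵢ[ℂ] K) : (H →L[ℂ] H) →⋆ₙₐ[ℂ] (K →L[ℂ] K) where
  toFun T := W.toContinuousLinearMap ∘L T ∘L ContinuousLinearMap.adjoint W.toContinuousLinearMap
  map_smul' c T := by ext; simp
  map_zero' := by ext; simp
  map_add' S T := by ext; simp
  map_mul' S T := by
    ext v
    simp [adjoint_isometry_apply]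
  map_star' T := by
    simp only [ContinuousLinearMap.star_eq_adjoint, ContinuousLinearMap.adjoint_comp,
      ContinuousLinearMap.adjoint_adjoint]
    rfl

theorem conjIsometry_apply (W : H →ₗᵢ[ℂ] K) (T : H →L[ℂ] H) (v : K) :
    conjIsometry W T v = W (T (ContinuousLinearMap.adjoint W.toContinuousLinearMap v)) := rfl

theorem conjIsometry_injective (W : H →ₗᵢ[ℂ] K) : Function.Injective (conjIsometry W) := by
  intro S T h
  ext v
  have := DFunLike.congr_fun h (W v)
  rw [conjIsometry_apply, conjIsometry_apply, adjoint_isometry_apply] at this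
  exact W.injective this

/-- The compression `b ↦ W* b W` along `W`. -/
def compress (W : H →ₗᵢ[ℂ] K) : (K →L[ℂ] K) →ₗ[ℂ] (H →L[ℂ] H) where
  toFun b := ContinuousLinearMap.adjoint W.toContinuousLinearMap ∘L b ∘L W.toContinuousLinearMap
  map_add' S T := by ext; simp
  map_smul' c T := by ext; simp

theorem compress_apply (W : H →ₗᵢ[ℂ] K) (b : K →L[ℂ] K) (v : H) :
    compress W b v = ContinuousLinearMap.adjoint W.toContinuousLinearMap (b (W v)) := rfl

theorem inner_compress (W : H →ₗᵢ[ℂ] K) (b : K →L[ℂ] K) (u v : H) :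
    inner ℂ u (compress W b v) = inner ℂ (W u) (b (W v)) := by
  rw [compress_apply, ContinuousLinearMap.adjoint_inner_right]
  rfl

theorem norm_compress_le (W : H →ₗᵢ[ℂ] K) (b : K →L[ℂ] K) : ‖compress W b‖ ≤ ‖b‖ := by
  refine ContinuousLinearMap.opNorm_le_bound _ (norm_nonneg _) fun v => ?_
  rw [compress_apply]
  have h1 : ‖ContinuousLinearMap.adjoint W.toContinuousLinearMap‖ ≤ 1 := by
    rw [LinearIsometryEquiv.norm_map]
    exact W.norm_toContinuousLinearMap_le
  calc _ ≤ 1 * ‖b (W v)‖ := ContinuousLinearMap.le_of_opNorm_le _ h1 _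
    _ ≤ ‖b‖ * ‖W v‖ := by rw [one_mul]; exact b.le_opNorm _
    _ = ‖b‖ * ‖v‖ := by rw [W.norm_map]

theorem continuous_compress (W : H →ₗᵢ[ℂ] K) : Continuous (compress W) :=
  AddMonoidHomClass.continuous_of_bound (compress W) 1 fun b => by
    simpa using norm_compress_le W b

/-- Up to the embedding `T ↦ W T W*`, compression along `W` is conjugation by the projection
`W W*`. -/
theorem conjIsometry_compress (W : H →ₗᵢ[ℂ] K) (b : K →L[ℂ] K) :
    conjIsometry W (compress W b) = star (conjIsometry W 1) * b * conjIsometry W 1 := by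
  rw [← map_star, star_one]
  ext v
  rfl

/-- A map between operator algebras that compresses along an isometry is contractive and completely
positive. -/
theorem isCCP_of_eq_compress (A : NonUnitalStarSubalgebra ℂ (K →L[ℂ] K))
    [IsClosed (A : Set (K →L[ℂ] K))] (B : StarSubalgebra ℂ (H →L[ℂ] H))
    [IsClosed (B : Set (H →L[ℂ] H))] (W : H →ₗᵢ[ℂ] K) (E : A →ₗ[ℂ] B)
    (hE : ∀ b, (E b : H →L[ℂ] H) = compress W b) : IsCCP E := by
  let _ := CStarAlgebra.spectralOrder A
  let _ := CStarAlgebra.spectralOrder B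
  have := CStarAlgebra.spectralOrderedRing A
  have := CStarAlgebra.spectralOrderedRing B
  refine ⟨⟨⟨E, fun k M hM => ?_⟩, rfl⟩, fun a => ?_⟩
  · let ρ : B →⋆ₙₐ[ℂ] (K →L[ℂ] K) :=
      (conjIsometry W).comp (NonUnitalStarSubalgebraClass.subtype B)
    have hρ : Function.Injective ρ := (conjIsometry_injective W).comp Subtype.val_injective
    let σ : A →⋆ₙₐ[ℂ] (K →L[ℂ] K) := NonUnitalStarSubalgebraClass.subtype A
    have hinj : Function.Injective (CStarMatrix.mapₙₐ (n := Fin k) ρ) :=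
      fun x y h => CStarMatrix.map_injective hρ h
    refine nonneg_of_map_nonneg (CStarMatrix.mapₙₐ ρ) hinj ?_
    -- On matrices, `ρ ∘ E` is conjugation by the diagonal matrix with entries `W W*`.
    let D : CStarMatrix (Fin k) (Fin k) (K →L[ℂ] K) :=
      CStarMatrix.ofMatrix (Matrix.diagonal fun _ => conjIsometry W 1)
    have key : CStarMatrix.mapₙₐ ρ (M.map E) = star D * CStarMatrix.mapₙₐ σ M * D := by
      ext1 i j
      have h1 : CStarMatrix.mapₙₐ ρ (M.map E) i j = conjIsometry W (E (M i j)) := rfl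
      have h2 : ∀ N : CStarMatrix (Fin k) (Fin k) (K →L[ℂ] K),
          (star D * N * D) i j = star (conjIsometry W 1) * N i j * conjIsometry W 1 := by
        intro N
        simp [CStarMatrix.mul_apply, CStarMatrix.star_apply, D, Matrix.diagonal_apply,
          apply_ite star]
      rw [h1, h2, hE, conjIsometry_compress]
      rfl
    have hpos : 0 ≤ CStarMatrix.mapₙₐ σ M := by
      obtain h := map_nonneg (CStarMatrix.mapₙₐ σ) hM
      exact h
    refine le_of_le_of_eq (star_left_conjugate_nonneg hpos D) ?_
    exact key.symm
  · change ‖(E a : H →L[ℂ] H)‖ ≤ ‖(a : K →L[ℂ] K)‖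
    rw [hE]
    exact norm_compress_le W _

/-- A `*`-homomorphism `τ` and a compression along `W` that restrict to maps between two operator
algebras `B` and `A`, with the compression a left inverse of `τ`, yield a faithful `*`-homomorphism
`B → A` with a contractive completely positive left inverse. -/
theorem exists_starHom_and_isCCP (A : NonUnitalStarSubalgebra ℂ (K →L[ℂ] K))
    [IsClosed (A : Set (K →L[ℂ] K))] (B : StarSubalgebra ℂ (H →L[ℂ] H))
    [IsClosed (B : Set (H →L[ℂ] H))] (W : H →ₗᵢ[ℂ] K) (τ : (H →L[ℂ] H) →⋆ₙₐ[ℂ] (K →L[ℂ] K))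
    (hτ : ∀ T, compress W (τ T) = T) (hA : ∀ T ∈ B, τ T ∈ A) (hB : ∀ b ∈ A, compress W b ∈ B) :
    ∃ (Φ : B →⋆ₙₐ[ℂ] A) (E : A →ₗ[ℂ] B), Function.Injective Φ ∧ IsCCP E ∧
      (∀ T : B, E (Φ T) = T) ∧ ∀ T : B, (Φ T : K →L[ℂ] K) = τ T := by
  let Φ : B →⋆ₙₐ[ℂ] A := NonUnitalStarAlgHom.codRestrict
    (τ.comp (NonUnitalStarSubalgebraClass.subtype B)) A fun T => hA T T.2
  let E : A →ₗ[ℂ] B :=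
    { toFun := fun b => ⟨compress W b, hB b b.2⟩
      map_add' := fun a b => Subtype.ext (map_add (compress W) (a : K →L[ℂ] K) b)
      map_smul' := fun c b => Subtype.ext (map_smul (compress W) c (b : K →L[ℂ] K)) }
  have hEΦ : ∀ T : B, E (Φ T) = T := fun T => Subtype.ext (hτ T)
  exact ⟨Φ, E, Function.LeftInverse.injective hEΦ,
    isCCP_of_eq_compress A B W E fun _ => rfl, hEΦ, fun _ => rfl⟩

end CStar

section Amplification

variable {H : Type*} [NormedAddCommGroup H] [InnerProductSpace ℂ H] [CompleteSpace H]

/-- The operator `T ⊗ 1` on the Hilbert sum of copies of `H`. -/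
def amplifyCLM (ι : Type*) (T : H →L[ℂ] H) :
    lp (fun _ : ι => H) 2 →L[ℂ] lp (fun _ : ι => H) 2 :=
  LinearMap.mkContinuous
    { toFun := fun f => ⟨fun i => T (f i), by
        refine ((lp.memℓp f).const_smul (‖T‖ : ℂ)).mono' fun i => ?_
        simpa [norm_smul] using T.le_opNorm (f i)⟩
      map_add' := fun f g => by ext i; exact map_add T (f i) (g i)
      map_smul' := fun c f => by ext i; exact map_smul T c (f i) } ‖T‖ (fun f => by
        have h : ‖((‖T‖ : ℂ) • f : lp (fun _ : ι => H) 2)‖ = ‖T‖ * ‖f‖ := by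
          rw [norm_smul]; simp
        rw [← h]
        refine lp.norm_mono (by simp) fun i => ?_
        change ‖T (f i)‖ ≤ ‖(‖T‖ : ℂ) • f i‖
        simpa [norm_smul] using T.le_opNorm (f i))

theorem amplifyCLM_apply {ι : Type*} (T : H →L[ℂ] H) (f : lp (fun _ : ι => H) 2) (i : ι) :
    amplifyCLM ι T f i = T (f i) := rfl

theorem amplifyCLM_star (ι : Type*) (T : H →L[ℂ] H) :
    amplifyCLM ι (star T) = star (amplifyCLM ι T) := by
  rw [ContinuousLinearMap.star_eq_adjoint (amplifyCLM ι T), ContinuousLinearMap.eq_adjoint_iff]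
  intro f g
  rw [lp.inner_eq_tsum, lp.inner_eq_tsum]
  refine tsum_congr fun i => ?_
  rw [amplifyCLM_apply, amplifyCLM_apply, ContinuousLinearMap.star_eq_adjoint]
  exact ContinuousLinearMap.adjoint_inner_left T _ _

/-- The amplification `T ↦ T ⊗ 1` as a `*`-homomorphism. -/
def amplify (ι : Type*) :
    (H →L[ℂ] H) →⋆ₙₐ[ℂ] (lp (fun _ : ι => H) 2 →L[ℂ] lp (fun _ : ι => H) 2) where
  toFun := amplifyCLM ι
  map_smul' c T := by ext f i; rfl
  map_zero' := by ext f i; rfl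
  map_add' S T := by ext f i; rfl
  map_mul' S T := by ext f i; rfl
  map_star' T := amplifyCLM_star ι T

theorem amplify_apply {ι : Type*} (T : H →L[ℂ] H) (f : lp (fun _ : ι => H) 2) (i : ι) :
    amplify (H := H) ι T f i = T (f i) := rfl

open Classical in
theorem amplify_single {ι : Type*} (T : H →L[ℂ] H) (i : ι) (v : H) :
    amplify (H := H) ι T (lp.single (E := fun _ : ι => H) 2 i v) = lp.single 2 i (T v) := by
  ext j
  rw [amplify_apply, lp.single_apply, lp.single_apply]
  by_cases h : j = i
  · subst h; simp
  · simp [h]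

end Amplification

/-! ### The modular function and inversion of Haar measure -/

section Modular

variable {G : Type*} [Group G] [TopologicalSpace G] [IsTopologicalGroup G]
  [LocallyCompactSpace G]

open Measure in
theorem continuous_modularCharacterFun :
    Continuous (modularCharacterFun : G → NNReal) := by
  borelize G
  let ν := haar (G := G)
  obtain ⟨⟨f, f_cont⟩, f_comp, f_nonneg, f_one⟩ :
    ∃ f : C(G, ℝ), HasCompactSupport f ∧ 0 ≤ f ∧ f 1 ≠ 0 := exists_continuous_nonneg_pos 1
  have h0 : ∫ x, f x ∂ν ≠ 0 :=
    ne_of_gt (f_cont.integral_pos_of_hasCompactSupport_nonneg_nonzero f_comp f_nonneg f_one)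
  have h1 : ∀ g : G, (modularCharacterFun g : ℝ) = (∫ x, f (x * g) ∂ν) / ∫ x, f x ∂ν := by
    intro g
    rw [modularCharacterFun_eq_haarScalarFactor ν,
      haarScalarFactor_eq_integral_div _ _ f_cont f_comp h0,
      integral_map (AEMeasurable.mul_const aemeasurable_id' _) f_cont.aestronglyMeasurable]
  have h2 : Continuous fun g : G => ∫ x, f (x * g) ∂ν := by
    have := continuous_integral_apply_inv_mul (μ := ν.inv) f_cont f_comp
    refine this.congr fun g => ?_
    have hc : Continuous fun y : G => f (y⁻¹ * g) := by fun_prop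
    rw [Measure.inv, integral_map (by fun_prop) hc.aestronglyMeasurable]
    simp
  have h3 : Continuous fun g : G => (modularCharacterFun g : ℝ) :=
    (h2.div_const _).congr fun g => (h1 g).symm
  exact NNReal.isEmbedding_coe.continuous_iff.2 h3

variable [SecondCountableTopology G] [MeasurableSpace G] [BorelSpace G]
  (μ : Measure G) [μ.IsHaarMeasure]

/-- The modular function of `G`, with values in `ℝ`. -/
def modular (g : G) : ℝ := (Measure.modularCharacter g : ℝ)

theorem modular_pos (g : G) : 0 < modular g := by
  exact_mod_cast Measure.modularCharacterFun_pos g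

theorem modular_mul (g h : G) : modular (g * h) = modular g * modular h := by
  simp [modular]

@[fun_prop]
theorem continuous_modular : Continuous (modular : G → ℝ) :=
  NNReal.continuous_coe.comp continuous_modularCharacterFun

/-- The measure with density `Δ` with respect to a left Haar measure is right invariant. -/
theorem map_mul_right_withDensity_modular (g : G) :
    (μ.withDensity fun t => ENNReal.ofReal (modular t)).map (· * g)
      = μ.withDensity fun t => ENNReal.ofReal (modular t) := by
  have hm : Measurable fun t : G => ENNReal.ofReal (modular t) := by fun_prop
  refine Measure.ext_of_lintegral _ fun f hf => ?_
  rw [lintegral_map hf (by fun_prop), lintegral_withDensity_eq_lintegral_mul _ hm (by fun_prop),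
    lintegral_withDensity_eq_lintegral_mul _ hm hf]
  have h1 := Measure.map_right_mul_eq_modularCharacterFun_smul μ g
  have h2 : ∫⁻ t, ENNReal.ofReal (modular (t * g)) * f (t * g) ∂μ
      = ENNReal.ofReal (modular g) * ∫⁻ t, ENNReal.ofReal (modular t) * f t ∂μ := by
    rw [← lintegral_map (f := fun t => ENNReal.ofReal (modular t) * f t) (by fun_prop)
      (by fun_prop : Measurable (· * g)), h1, lintegral_smul_measure]
    simp [modular, Measure.modularCharacter, ENNReal.smul_def]
  have h3 : ∀ t, ENNReal.ofReal (modular (t * g)) * f (t * g)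
      = ENNReal.ofReal (modular g) * (ENNReal.ofReal (modular t) * f (t * g)) := by
    intro t
    rw [modular_mul, ENNReal.ofReal_mul (modular_pos t).le]
    ring
  simp only [h3] at h2
  rw [lintegral_const_mul _ (by fun_prop)] at h2
  exact (ENNReal.mul_right_inj (by simpa using modular_pos g) ENNReal.ofReal_ne_top).1 h2

/-- Inversion carries a left Haar measure to a multiple of the measure with density `Δ`. -/
theorem exists_inv_eq_smul_withDensity_modular :
    ∃ c : NNReal, 0 < c ∧
      μ.withDensity (fun t => ENNReal.ofReal (modular t)) = c • μ.inv := by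
  set ν := μ.withDensity (fun t : G => ENNReal.ofReal (modular t)) with hν
  have : IsLocallyFiniteMeasure ν := IsLocallyFiniteMeasure.withDensity_ofReal continuous_modular
  have : ν.IsMulRightInvariant := ⟨map_mul_right_withDensity_modular μ⟩
  have : ν.inv.IsMulLeftInvariant := inferInstance
  have : IsFiniteMeasureOnCompacts ν.inv := by
    refine ⟨fun K hK => ?_⟩
    rw [Measure.inv_apply]
    exact hK.inv.measure_lt_top
  have h := Measure.isMulLeftInvariant_eq_smul ν.inv μ
  refine ⟨Measure.haarScalarFactor ν.inv μ, ?_, ?_⟩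
  · refine pos_iff_ne_zero.2 fun h0 => ?_
    rw [h0, zero_smul] at h
    have h1 : ν = 0 := by rw [← ν.inv_inv, h]; simp [Measure.inv]
    rw [hν, withDensity_eq_zero_iff (by fun_prop)] at h1
    have h2 : ∀ᵐ t ∂μ, False := by
      filter_upwards [h1] with t ht
      have := modular_pos t
      simp at ht
      linarith
    simp at h2
    exact NeZero.ne μ h2
  · conv_lhs => rw [← ν.inv_inv, h]
    simp [Measure.inv, Measure.map_smul]

/-- The constant `c > 0` for which `Δ μ = c • μ.inv`. Its value is `1`, but the argument only needs
that it is positive. -/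
def invConst : ℝ := ((exists_inv_eq_smul_withDensity_modular μ).choose : ℝ)

theorem invConst_pos : 0 < invConst μ := by
  exact_mod_cast (exists_inv_eq_smul_withDensity_modular μ).choose_spec.1

/-- The defining property of `invConst`, with the constant as an element of `ℝ≥0`, the type of
scalars that act on measures. -/
theorem exists_invConst_eq : ∃ c : NNReal, invConst μ = c ∧
    μ.withDensity (fun t => ENNReal.ofReal (modular t)) = c • μ.inv :=
  ⟨_, rfl, (exists_inv_eq_smul_withDensity_modular μ).choose_spec.2⟩

theorem lintegral_modular_mul {f : G → ℝ≥0∞} (hf : Measurable f) :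
    ∫⁻ t, ENNReal.ofReal (modular t) * f t ∂μ
      = ENNReal.ofReal (invConst μ) * ∫⁻ t, f t⁻¹ ∂μ := by
  obtain ⟨c, hc, h⟩ := exists_invConst_eq μ
  have h1 := congrArg (fun ν => ∫⁻ t, f t ∂ν) h
  beta_reduce at h1
  rw [lintegral_withDensity_eq_lintegral_mul _ (by fun_prop) hf, lintegral_smul_measure,
    Measure.inv, lintegral_map hf (by fun_prop)] at h1
  simpa [hc, ENNReal.smul_def] using h1

/-- `∫ Δ(t) f(g t⁻¹) dt` does not depend on `g`. -/
theorem lintegral_modular_mul_mul_inv {f : G → ℝ≥0∞} (hf : Measurable f) (g : G) :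
    ∫⁻ t, ENNReal.ofReal (modular t) * f (g * t⁻¹) ∂μ
      = ENNReal.ofReal (invConst μ) * ∫⁻ t, f t ∂μ := by
  rw [lintegral_modular_mul μ (f := fun t => f (g * t⁻¹)) (by fun_prop)]
  simp [lintegral_mul_left_eq_self]

theorem integral_modular_mul {f : G → ℂ} (hf : Continuous f) (t : G) :
    ∫ s, (modular s : ℂ) * f s ∂μ = invConst μ * ∫ s, f (s⁻¹ * t) ∂μ := by
  obtain ⟨c, hc, h⟩ := exists_invConst_eq μ
  have h1 := congrArg (fun ν => ∫ t, f t ∂ν) h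
  beta_reduce at h1
  have h2 : (fun t : G => ENNReal.ofReal (modular t))
      = fun t => ((Real.toNNReal (modular t) : NNReal) : ℝ≥0∞) := rfl
  rw [h2, integral_withDensity_eq_integral_smul (by fun_prop), integral_smul_nnreal_measure,
    Measure.inv, integral_map (by fun_prop) (by fun_prop)] at h1
  have h3 : ∫ s, f (s⁻¹ * t) ∂μ = ∫ s, f s⁻¹ ∂μ := by
    rw [← integral_mul_left_eq_self (fun s => f s⁻¹) t⁻¹]
    simp
  rw [h3]
  have h4 : ∀ s : G, (modular s : ℂ) * f s = Real.toNNReal (modular s) • f s := by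
    intro s
    rw [NNReal.smul_def, Real.coe_toNNReal _ (modular_pos s).le]
    rfl
  simp only [h4]
  rw [h1, hc]
  rfl

end Modular

/-! ### Covariance relations for regular representations -/

section Covariance

variable {G : Type*} [Group G] [TopologicalSpace G] [IsTopologicalGroup G] [T2Space G]
  [LocallyCompactSpace G] [SecondCountableTopology G] [MeasurableSpace G] [BorelSpace G]
  (μ : Measure G)
variable {A H : Type*} [NonUnitalCStarAlgebra A]
  [NormedAddCommGroup H] [InnerProductSpace ℂ H] [CompleteSpace H]
  (α : CStarAction G A) (π : A →⋆ₙₐ[ℂ] (H →L[ℂ] H))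

theorem inducedRep_zero : inducedRep μ α π 0 = 0 := by
  simpa using inducedRep_sub μ α π 0 0

theorem inducedRep_mul (a b : A) :
    inducedRep μ α π (a * b) = inducedRep μ α π a * inducedRep μ α π b := by
  ext ξ
  filter_upwards [inducedRep_coe μ α π (a * b) ξ, inducedRep_coe μ α π b ξ,
    inducedRep_coe μ α π a (inducedRep μ α π b ξ)] with t h1 h2 h3
  rw [h1, _root_.mul_apply_eq_comp, h3, h2]
  simp

theorem inducedRep_add (a b : A) :
    inducedRep μ α π (a + b) = inducedRep μ α π a + inducedRep μ α π b := by
  have h := inducedRep_sub μ α π (a + b) b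
  rw [add_sub_cancel_right] at h
  rw [h, sub_add_cancel]

theorem inducedRep_smul (c : ℂ) (a : A) :
    inducedRep μ α π (c • a) = c • inducedRep μ α π a := by
  ext ξ
  filter_upwards [inducedRep_coe μ α π (c • a) ξ, inducedRep_coe μ α π a ξ,
    Lp.coeFn_smul c (inducedRep μ α π a ξ)] with t h1 h2 h3
  rw [h1, _root_.smul_apply, h3, Pi.smul_apply, h2]
  simp

theorem inducedRep_star (a : A) : inducedRep μ α π (star a) = star (inducedRep μ α π a) := by
  rw [ContinuousLinearMap.star_eq_adjoint (inducedRep μ α π a),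
    ContinuousLinearMap.eq_adjoint_iff]
  intro ξ η
  rw [MeasureTheory.L2.inner_def, MeasureTheory.L2.inner_def]
  apply integral_congr_ae
  filter_upwards [inducedRep_coe μ α π (star a) ξ, inducedRep_coe μ α π a η] with t h1 h2
  rw [h1, h2, map_star, map_star, ContinuousLinearMap.star_eq_adjoint]
  exact ContinuousLinearMap.adjoint_inner_left _ _ _

/-- The covariance relation `(λ_s ⊗ 1) π_α(a) = π_α(α_s(a)) (λ_s ⊗ 1)`. -/
theorem leftReg_inducedRep [μ.IsMulLeftInvariant] (s : G) (a : A) (ξ : L2 μ H) :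
    leftReg μ H s (inducedRep μ α π a ξ) = inducedRep μ α π (α.act s a) (leftReg μ H s ξ) := by
  ext1
  have h0 := (measurePreserving_mul_left μ s⁻¹).quasiMeasurePreserving.ae
    (inducedRep_coe μ α π a ξ)
  filter_upwards [h0, leftReg_coe μ s ξ, leftReg_coe μ s (inducedRep μ α π a ξ),
    inducedRep_coe μ α π (α.act s a) (leftReg μ H s ξ)] with t h1 h2 h3 h4
  rw [h3, h4, h1, h2, mul_inv_rev, inv_inv, map_mul]
  rfl

variable [μ.IsHaarMeasure]

theorem inducedRep_regularRep (a : A) (f : C_c(G, A)) (ξ : L2 μ H) :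
    inducedRep μ α π a (regularRep μ α π f ξ)
      = ∫ s, inducedRep μ α π (a * f s) (leftReg μ H s ξ) ∂μ := by
  rw [regularRep_apply, ← ContinuousLinearMap.integral_comp_comm _ (integrable_regular μ α π f ξ)]
  simp only [inducedRep_mul, _root_.mul_apply_eq_comp]

theorem regularRep_inducedRep (a : A) (f : C_c(G, A)) (ξ : L2 μ H) :
    regularRep μ α π f (inducedRep μ α π a ξ)
      = ∫ s, inducedRep μ α π (f s * α.act s a) (leftReg μ H s ξ) ∂μ := by
  rw [regularRep_apply]
  simp only [inducedRep_mul, _root_.mul_apply_eq_comp, leftReg_inducedRep]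

/-- The regular representation is contractive for the `L¹`-norm. The coefficient function is not
bundled, so that the bound applies to differences of elements of `C_c(G, A)` as they arise. -/
theorem norm_integral_inducedRep_le {f : G → A} {g : G → ℝ} (hg : Integrable g μ)
    (hfg : ∀ s, ‖f s‖ ≤ g s) (ξ : L2 μ H) :
    ‖∫ s, inducedRep μ α π (f s) (leftReg μ H s ξ) ∂μ‖ ≤ (∫ s, g s ∂μ) * ‖ξ‖ := by
  rw [← integral_mul_const]
  refine norm_integral_le_of_norm_le (hg.mul_const _) (Eventually.of_forall fun s => ?_)
  refine (ContinuousLinearMap.le_opNorm _ _).trans ?_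
  rw [norm_leftReg_apply]
  gcongr
  exact (norm_inducedRep_le μ α π (f s)).trans (hfg s)

theorem integrable_inducedRep {f : G → A} (hf : Continuous f) (hc : HasCompactSupport f)
    (ξ : L2 μ H) : Integrable (fun s => inducedRep μ α π (f s) (leftReg μ H s ξ)) μ :=
  integrable_regular μ α π ⟨⟨f, hf⟩, hc⟩ ξ

theorem regularRep_add (f g : C_c(G, A)) :
    regularRep μ α π (f + g) = regularRep μ α π f + regularRep μ α π g := by
  ext1 ξ
  rw [_root_.add_apply, regularRep_apply, regularRep_apply, regularRep_apply,
    ← integral_add (integrable_regular μ α π f ξ) (integrable_regular μ α π g ξ)]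
  simp [inducedRep_add]

theorem regularRep_smul (c : ℂ) (f : C_c(G, A)) :
    regularRep μ α π (c • f) = c • regularRep μ α π f := by
  ext1 ξ
  rw [_root_.smul_apply, regularRep_apply, regularRep_apply, ← integral_smul]
  simp [inducedRep_smul]

/-- The regular representation as a linear map on `C_c(G, A)`. -/
def regularRepₗ : C_c(G, A) →ₗ[ℂ] (L2 μ H →L[ℂ] L2 μ H) where
  toFun := regularRep μ α π
  map_add' := regularRep_add μ α π
  map_smul' := regularRep_smul μ α π

end Covariance

/-! ### Lipschitz functions on a group with a left-invariant metric -/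

section Lipschitz

variable {G : Type*} [Group G] [MetricSpace G] [IsTopologicalGroup G]

/-- A bounded Lipschitz function, as an element of `C_b^{ru}(G)` : by left invariance of the metric
`d(xg, x) = d(g, e)` for all `x`. -/
def lipschitzCbru (hd : ∀ g x y : G, dist (g * x) (g * y) = dist x y) (F : G → ℂ) (K C : ℝ)
    (hK : ∀ x y, ‖F x - F y‖ ≤ K * dist x y) (hC : ∀ x, ‖F x‖ ≤ C) : Cbru G :=
  ⟨BoundedContinuousFunction.ofNormedAddCommGroup F
    (LipschitzWith.of_dist_le_mul (K := K.toNNReal) fun x y => by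
      rw [dist_eq_norm]
      exact (hK x y).trans (by gcongr; exact Real.le_coe_toNNReal K)).continuous C hC, by
    intro ε hε
    have h : Tendsto (fun g : G => K * dist g 1) (𝓝 1) (𝓝 0) := by
      have : Continuous fun g : G => K * dist g 1 := by fun_prop
      simpa using this.tendsto 1
    filter_upwards [h.eventually (gt_mem_nhds hε)] with g hg x
    refine (hK (x * g) x).trans ?_
    have := hd x g 1
    rw [mul_one] at this
    rw [this]
    exact hg.le⟩

/-- The truncation of a `1`-Lipschitz function to the interval `[0, 1]`. -/
def truncCbru (hd : ∀ g x y : G, dist (g * x) (g * y) = dist x y) (ψ : G → ℝ)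
    (hψ : ∀ x y, |ψ x - ψ y| ≤ dist x y) : Cbru G :=
  lipschitzCbru hd (fun x => ((max 0 (min 1 (ψ x)) : ℝ) : ℂ)) 1 1
    (fun x y => by
      rw [← Complex.ofReal_sub, Complex.norm_real, Real.norm_eq_abs, one_mul]
      refine (abs_max_sub_max_le_max _ _ _ _).trans ?_
      rw [sub_self, abs_zero, max_eq_right (abs_nonneg _)]
      refine (abs_min_sub_min_le_max _ _ _ _).trans ?_
      rw [sub_self, abs_zero, max_eq_right (abs_nonneg _)]
      exact hψ x y)
    (fun x => by
      rw [Complex.norm_real, Real.norm_eq_abs, abs_of_nonneg (le_max_left _ _)]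
      exact max_le zero_le_one (min_le_left _ _))

variable (hd : ∀ g x y : G, dist (g * x) (g * y) = dist x y)

theorem truncCbru_apply (ψ : G → ℝ) (hψ : ∀ x y, |ψ x - ψ y| ≤ dist x y) (x : G) :
    (truncCbru hd ψ hψ : G →ᵇ ℂ) x = ((max 0 (min 1 (ψ x)) : ℝ) : ℂ) := rfl

theorem truncCbru_eq_one (ψ : G → ℝ) (hψ : ∀ x y, |ψ x - ψ y| ≤ dist x y) {x : G}
    (hx : 1 ≤ ψ x) : (truncCbru hd ψ hψ : G →ᵇ ℂ) x = 1 := by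
  rw [truncCbru_apply, min_eq_left hx]
  simp

theorem truncCbru_eq_zero (ψ : G → ℝ) (hψ : ∀ x y, |ψ x - ψ y| ≤ dist x y) {x : G}
    (hx : ψ x ≤ 0) : (truncCbru hd ψ hψ : G →ᵇ ℂ) x = 0 := by
  rw [truncCbru_apply, max_eq_left ((min_le_right _ _).trans hx)]
  simp

theorem norm_truncCbru_apply_le (ψ : G → ℝ) (hψ : ∀ x y, |ψ x - ψ y| ≤ dist x y) (x : G) :
    ‖(truncCbru hd ψ hψ : G →ᵇ ℂ) x‖ ≤ 1 := by
  rw [truncCbru_apply, Complex.norm_real, Real.norm_eq_abs, abs_of_nonneg (le_max_left _ _)]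
  exact max_le zero_le_one (min_le_left _ _)

theorem star_truncCbru (ψ : G → ℝ) (hψ : ∀ x y, |ψ x - ψ y| ≤ dist x y) :
    star (truncCbru hd ψ hψ) = truncCbru hd ψ hψ := by
  ext x
  change star ((truncCbru hd ψ hψ : G →ᵇ ℂ) x) = (truncCbru hd ψ hψ : G →ᵇ ℂ) x
  rw [truncCbru_apply]
  exact Complex.conj_ofReal _

/-- Cutoff functions that increase to `1` : the `n`-th one is `1` on the ball of radius `n` about
the identity and vanishes off the ball of radius `n + 1`. -/
def cutoff (n : ℕ) : Cbru G :=
  truncCbru hd (fun x => n + 1 - dist 1 x) fun x y => by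
    have := abs_dist_sub_le y x (1 : G)
    rw [dist_comm y, dist_comm x, dist_comm y] at this
    calc _ = |dist 1 y - dist 1 x| := by congr 1; ring
      _ ≤ _ := this

theorem cutoff_eq_one {n : ℕ} {x : G} (hx : dist 1 x ≤ n) : (cutoff hd n : G →ᵇ ℂ) x = 1 :=
  truncCbru_eq_one hd _ _ (by linarith)

theorem cutoff_eq_zero {n : ℕ} {x : G} (hx : n + 1 ≤ dist 1 x) : (cutoff hd n : G →ᵇ ℂ) x = 0 :=
  truncCbru_eq_zero hd _ _ (by linarith)

theorem norm_cutoff_apply_le (n : ℕ) (x : G) : ‖(cutoff hd n : G →ᵇ ℂ) x‖ ≤ 1 :=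
  norm_truncCbru_apply_le hd _ _ x

theorem norm_cutoff_le (n : ℕ) : ‖cutoff hd n‖ ≤ 1 :=
  (BoundedContinuousFunction.norm_le zero_le_one).2 (norm_cutoff_apply_le hd n)

theorem star_cutoff (n : ℕ) : star (cutoff hd n) = cutoff hd n := star_truncCbru hd _ _

end Lipschitz

/-! ### Propagation and decay of elements of the crossed products -/

section Propagation

variable {G : Type*} [Group G] [MetricSpace G] [IsTopologicalGroup G] [ProperSpace G]
  [MeasurableSpace G] [BorelSpace G]

section NoHaar
variable (μ : Measure G)

/-- The representation of `C_b^{ru}(G)` on `L²(G, L²(G))` that the crossed product is built from. -/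
abbrev mulOp (h : Cbru G) : L2 μ (L2 μ ℂ) →L[ℂ] L2 μ (L2 μ ℂ) :=
  inducedRep μ (actionCbru G) (repCbru μ) h

theorem mulOp_coe (h : Cbru G) (ξ : L2 μ (L2 μ ℂ)) :
    mulOp μ h ξ =ᵐ[μ] fun t => mulRep μ (rightTranslate t⁻¹ (h : G →ᵇ ℂ)) (ξ t) :=
  inducedRep_coe μ (actionCbru G) (repCbru μ) h ξ

theorem mulOp_one : mulOp μ (1 : Cbru G) = 1 := by
  ext1 ξ
  ext1
  filter_upwards [mulOp_coe μ 1 ξ] with t h1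
  rw [h1]
  ext1
  filter_upwards [mulRep_coe μ (rightTranslate t⁻¹ ((1 : Cbru G) : G →ᵇ ℂ)) (ξ t)] with x h2
  rw [h2]
  exact one_mul _

/-- `b` has propagation at most `R` : `M(h) b M(h') = 0` as soon as the supports of `h` and `h'`
are more than `R` apart. -/
def HasPropagation (b : L2 μ (L2 μ ℂ) →L[ℂ] L2 μ (L2 μ ℂ)) (R : ℝ) : Prop :=
  ∀ h h' : Cbru G, (∀ x y : G, (h : G →ᵇ ℂ) x ≠ 0 → (h' : G →ᵇ ℂ) y ≠ 0 → R < dist x y) →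
    mulOp μ h * b * mulOp μ h' = 0

variable {μ}

theorem HasPropagation.mono {b : L2 μ (L2 μ ℂ) →L[ℂ] L2 μ (L2 μ ℂ)} {R S : ℝ}
    (hb : HasPropagation μ b R) (hRS : R ≤ S) : HasPropagation μ b S :=
  fun h h' hh => hb h h' fun x y hx hy => hRS.trans_lt (hh x y hx hy)

theorem HasPropagation.add {a b : L2 μ (L2 μ ℂ) →L[ℂ] L2 μ (L2 μ ℂ)} {R S : ℝ}
    (ha : HasPropagation μ a R) (hb : HasPropagation μ b S) :
    HasPropagation μ (a + b) (max R S) := fun h h' hh => by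
  rw [mul_add, add_mul, ha.mono (le_max_left R S) h h' hh, hb.mono (le_max_right R S) h h' hh,
    add_zero]

theorem HasPropagation.star {b : L2 μ (L2 μ ℂ) →L[ℂ] L2 μ (L2 μ ℂ)} {R : ℝ}
    (hb : HasPropagation μ b R) : HasPropagation μ (star b) R := fun h h' hh => by
  have h1 := hb (Star.star h') (Star.star h) fun x y hx hy => by
    rw [dist_comm]
    exact hh y x (star_ne_zero.1 hy) (star_ne_zero.1 hx)
  have h2 := congrArg Star.star h1
  rw [mulOp, mulOp, inducedRep_star, inducedRep_star, star_zero, star_mul, star_mul, star_star,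
    star_star, ← mul_assoc] at h2
  exact h2

/-- The supports of the two factors are separated by a plateau function that is `1` near the first
one. -/
theorem HasPropagation.mul (hd : ∀ g x y : G, dist (g * x) (g * y) = dist x y)
    {a b : L2 μ (L2 μ ℂ) →L[ℂ] L2 μ (L2 μ ℂ)} {R S : ℝ}
    (ha : HasPropagation μ a R) (hb : HasPropagation μ b S) :
    HasPropagation μ (a * b) (R + S + 2) := fun h h' hh => by
  by_cases hne : ∃ x₀, (h : G →ᵇ ℂ) x₀ ≠ 0
  swap
  · push Not at hne
    have : h = 0 := by ext x; exact hne x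
    rw [this, mulOp, inducedRep_zero, zero_mul, zero_mul]
  let s : Set G := {x | (h : G →ᵇ ℂ) x ≠ 0}
  have hs : s.Nonempty := hne
  let χ : Cbru G := truncCbru hd (fun x => R + 2 - Metric.infDist x s) fun x y => by
    have h1 := Metric.infDist_le_infDist_add_dist (s := s) (x := x) (y := y)
    have h2 := Metric.infDist_le_infDist_add_dist (s := s) (x := y) (y := x)
    rw [dist_comm y x] at h2
    rw [abs_le]
    constructor <;> linarith
  have e1 : mulOp μ h * a * mulOp μ (1 - χ) = 0 := ha h (1 - χ) fun x y hx hy => by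
    by_contra hcon
    push Not at hcon
    apply hy
    have h3 : Metric.infDist y s ≤ R :=
      (Metric.infDist_le_dist_of_mem (show x ∈ s from hx)).trans (by rwa [dist_comm])
    change 1 - (χ : G →ᵇ ℂ) y = 0
    rw [truncCbru_eq_one hd _ _ (by linarith), sub_self]
  have e2 : mulOp μ χ * b * mulOp μ h' = 0 := hb χ h' fun x y hx hy => by
    have h3 : Metric.infDist x s < R + 2 := by
      by_contra hcon
      push Not at hcon
      exact hx (truncCbru_eq_zero hd _ _ (by linarith))
    obtain ⟨z, hz, hxz⟩ := (Metric.infDist_lt_iff hs).1 h3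
    have h4 := hh z y hz hy
    have h5 := dist_triangle z x y
    rw [dist_comm z x] at h5
    linarith
  have e3 : mulOp μ (1 - χ) + mulOp μ χ = 1 := by
    rw [mulOp, mulOp, ← inducedRep_add, sub_add_cancel]
    exact mulOp_one μ
  calc mulOp μ h * (a * b) * mulOp μ h'
      = mulOp μ h * a * (mulOp μ (1 - χ) + mulOp μ χ) * b * mulOp μ h' := by
        rw [e3]; noncomm_ring
    _ = (mulOp μ h * a * mulOp μ (1 - χ)) * b * mulOp μ h'
        + mulOp μ h * a * (mulOp μ χ * b * mulOp μ h') := by noncomm_ring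
    _ = 0 := by rw [e1, e2]; simp

end NoHaar

variable (hd : ∀ g x y : G, dist (g * x) (g * y) = dist x y)
variable (μ : Measure G) [μ.IsHaarMeasure]

/-- The `*`-algebra of the operators of finite propagation on `L²(G, L²(G))`. -/
def finProp : NonUnitalStarSubalgebra ℂ (L2 μ (L2 μ ℂ) →L[ℂ] L2 μ (L2 μ ℂ)) where
  carrier := {b | ∃ R, HasPropagation μ b R}
  add_mem' := fun ⟨_, ha⟩ ⟨_, hb⟩ => ⟨_, ha.add hb⟩
  zero_mem' := ⟨0, fun h h' _ => by rw [mul_zero, zero_mul]⟩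
  mul_mem' := fun ⟨_, ha⟩ ⟨_, hb⟩ => ⟨_, ha.mul hd hb⟩
  smul_mem' := fun c _ ⟨R, hb⟩ => ⟨R, fun h h' hh => by
    rw [mul_smul_comm, smul_mul_assoc, hb h h' hh, smul_zero]⟩
  star_mem' := fun ⟨_, hb⟩ => ⟨_, hb.star⟩

/-- If `f` is supported in the ball of radius `R` about the identity, its convolution operator has
propagation at most `R`, because `d(x, xs) = d(e, s)`. -/
theorem regularRep_mem_finProp (f : C_c(G, Cbru G)) :
    regularRep μ (actionCbru G) (repCbru μ) f ∈ finProp hd μ := by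
  obtain ⟨R, hR⟩ := f.hasCompactSupport.isCompact.isBounded.subset_closedBall (1 : G)
  refine ⟨R, fun h h' hh => ?_⟩
  ext1 ξ
  rw [_root_.mul_apply_eq_comp, _root_.mul_apply_eq_comp, regularRep_inducedRep,
    ← ContinuousLinearMap.integral_comp_comm]
  · have h0 : ∀ s, mulOp μ h (inducedRep μ (actionCbru G) (repCbru μ)
        (f s * (actionCbru G).act s h') (leftReg μ (L2 μ ℂ) s ξ)) = 0 := by
      intro s
      rw [← _root_.mul_apply_eq_comp, ← inducedRep_mul]
      have h1 : h * (f s * (actionCbru G).act s h') = 0 := by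
        ext x
        change (h : G →ᵇ ℂ) x * ((f s : G →ᵇ ℂ) x * (h' : G →ᵇ ℂ) (x * s)) = 0
        by_cases hx : (h : G →ᵇ ℂ) x = 0
        · rw [hx, zero_mul]
        by_cases hy : (h' : G →ᵇ ℂ) (x * s) = 0
        · rw [hy, mul_zero, mul_zero]
        have h2 := hh x (x * s) hx hy
        have h3 : f s = 0 := by
          by_contra hs
          have h4 := hR (subset_tsupport _ hs)
          rw [Metric.mem_closedBall, dist_comm] at h4
          have h5 := hd x 1 s
          rw [mul_one] at h5
          linarith
        rw [h3]
        simp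
      rw [h1, inducedRep_zero]
      rfl
    simp [h0]
  · have := integrable_regular μ (actionCbru G) (repCbru μ) f (mulOp μ h' ξ)
    simpa only [inducedRep_mul, _root_.mul_apply_eq_comp, leftReg_inducedRep] using this

theorem adjoin_le_finProp :
    NonUnitalStarAlgebra.adjoin ℂ (Set.range (regularRep μ (actionCbru G) (repCbru μ)))
      ≤ finProp hd μ :=
  NonUnitalStarAlgebra.adjoin_le (by rintro _ ⟨f, rfl⟩; exact regularRep_mem_finProp hd μ f)

theorem norm_mulOp_cutoff_le (n : ℕ) : ‖mulOp μ (cutoff hd n)‖ ≤ 1 :=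
  (norm_inducedRep_le μ _ _ _).trans (norm_cutoff_le hd n)

theorem star_mulOp_cutoff (n : ℕ) :
    star (mulOp μ (cutoff hd n)) = mulOp μ (cutoff hd n) := by
  rw [mulOp, ← inducedRep_star, star_cutoff]

/-- The C*-algebra of the operators on `L²(G, L²(G))` for which the multiplication operators by the
cutoff functions form a two-sided approximate unit. -/
def decaying : NonUnitalStarSubalgebra ℂ (L2 μ (L2 μ ℂ) →L[ℂ] L2 μ (L2 μ ℂ)) where
  carrier := {b | Tendsto (fun n => b * mulOp μ (cutoff hd n)) atTop (𝓝 b) ∧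
    Tendsto (fun n => mulOp μ (cutoff hd n) * b) atTop (𝓝 b)}
  add_mem' := fun ⟨ha, ha'⟩ ⟨hb, hb'⟩ =>
    ⟨by simpa only [add_mul] using ha.add hb, by simpa only [mul_add] using ha'.add hb'⟩
  zero_mem' := by simp
  mul_mem' := fun {a b} ⟨_, ha'⟩ ⟨hb, _⟩ =>
    ⟨by simpa only [mul_assoc] using hb.const_mul a, by simpa only [mul_assoc] using ha'.mul_const b⟩
  smul_mem' := fun c _ ⟨hb, hb'⟩ =>
    ⟨by simpa only [smul_mul_assoc] using hb.const_smul c,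
      by simpa only [mul_smul_comm] using hb'.const_smul c⟩
  star_mem' := fun ⟨hb, hb'⟩ =>
    ⟨by simpa only [star_mul, star_mulOp_cutoff] using hb'.star,
      by simpa only [star_mul, star_mulOp_cutoff] using hb.star⟩

/-- For maps `L n` that are uniformly `1`-Lipschitz, convergence `L n b → b` is a closed condition
on `b`. -/
theorem isClosed_setOf_tendsto_self {E : Type*} [PseudoMetricSpace E] (L : ℕ → E → E)
    (hL : ∀ n x y, dist (L n x) (L n y) ≤ dist x y) :
    IsClosed {b | Tendsto (fun n => L n b) atTop (𝓝 b)} := by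
  refine isClosed_of_closure_subset fun b hb => Metric.tendsto_atTop.2 fun ε hε => ?_
  obtain ⟨b', hb', h⟩ := Metric.mem_closure_iff.1 hb (ε / 3) (by positivity)
  obtain ⟨N, hN⟩ := Metric.tendsto_atTop.1 hb' (ε / 3) (by positivity)
  refine ⟨N, fun n hn => ?_⟩
  have h1 := dist_triangle4 (L n b) (L n b') b' b
  have h2 := hL n b b'
  have h3 := hN n hn
  rw [dist_comm b' b] at h1
  linarith

theorem isClosed_decaying :
    IsClosed (decaying hd μ : Set (L2 μ (L2 μ ℂ) →L[ℂ] L2 μ (L2 μ ℂ))) := by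
  refine IsClosed.inter (isClosed_setOf_tendsto_self (fun n b => b * mulOp μ (cutoff hd n)) ?_)
    (isClosed_setOf_tendsto_self (fun n b => mulOp μ (cutoff hd n) * b) ?_)
  · intro n a b
    rw [dist_eq_norm, dist_eq_norm, ← sub_mul]
    exact (norm_mul_le _ _).trans
      (mul_le_of_le_one_right (norm_nonneg _) (norm_mulOp_cutoff_le hd μ n))
  · intro n a b
    rw [dist_eq_norm, dist_eq_norm, ← mul_sub]
    exact (norm_mul_le _ _).trans
      (mul_le_of_le_one_left (norm_nonneg _) (norm_mulOp_cutoff_le hd μ n))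

/-- Translated cutoff functions act as an approximate unit on `C_0(G)`. -/
theorem tendsto_mul_act_cutoff {F : Cbru G} (f : C₀(G, ℂ)) (hF : ∀ x, (F : G →ᵇ ℂ) x = f x)
    (u : G) :
    Tendsto (fun n => ‖F - F * (actionCbru G).act u (cutoff hd n)‖) atTop (𝓝 0) := by
  rw [Metric.tendsto_atTop]
  intro ε hε
  have h1 : ∀ᶠ x in cocompact G, ‖f x‖ < ε / 4 := by
    have := (zero_at_infty f).norm
    rw [norm_zero] at this
    exact this.eventually (gt_mem_nhds (by positivity))
  obtain ⟨K, hK, hKf⟩ := Filter.mem_cocompact.1 h1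
  obtain ⟨m, hm⟩ := hK.isBounded.subset_closedBall (1 : G)
  obtain ⟨N, hN⟩ := exists_nat_ge (m + dist 1 u)
  refine ⟨N, fun n hn => ?_⟩
  rw [Real.dist_eq, sub_zero, abs_of_nonneg (norm_nonneg _)]
  refine lt_of_le_of_lt ((BoundedContinuousFunction.norm_le (by positivity)).2 fun x => ?_)
    (half_lt_self hε)
  change ‖(F : G →ᵇ ℂ) x - (F : G →ᵇ ℂ) x * (cutoff hd n : G →ᵇ ℂ) (x * u)‖ ≤ ε / 2
  by_cases hx : x ∈ K
  · have h2 : dist 1 (x * u) ≤ n := by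
      have h3 := hm hx
      rw [Metric.mem_closedBall, dist_comm] at h3
      have h4 := hd x 1 u
      rw [mul_one] at h4
      have h5 := dist_triangle 1 x (x * u)
      have h6 : (N : ℝ) ≤ n := by exact_mod_cast hn
      linarith
    rw [cutoff_eq_one hd h2, mul_one, sub_self, norm_zero]
    positivity
  · have h2 : ‖f x‖ < ε / 4 := hKf hx
    calc _ ≤ ‖(F : G →ᵇ ℂ) x‖ + ‖(F : G →ᵇ ℂ) x‖ * ‖(cutoff hd n : G →ᵇ ℂ) (x * u)‖ := by
          rw [← norm_mul]
          exact norm_sub_le _ _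
      _ ≤ ε / 4 + ε / 4 * 1 := by
          rw [hF]
          gcongr
          exact norm_cutoff_apply_le hd n _
      _ = ε / 2 := by ring

/-- Dominated convergence in the `L¹`-norm: cutting off the coefficients of a convolution element
with coefficients in `C_0(G)` does not change it in the limit. -/
theorem tendsto_of_cutoff (f : C_c(G, C₀(G, ℂ))) (u : G → G) (hu : Continuous u)
    (T : ℕ → L2 μ (L2 μ ℂ) →L[ℂ] L2 μ (L2 μ ℂ))
    (hT : ∀ n ξ, T n ξ = ∫ s, mulOp μ (⟨inclC0 G (f s), inclC0_mem (f s)⟩ *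
      (actionCbru G).act (u s) (cutoff hd n)) (leftReg μ (L2 μ ℂ) s ξ) ∂μ) :
    Tendsto T atTop (𝓝 (regularRep μ (actionC0 G) (repC0 μ) f)) := by
  let F : G → Cbru G := fun s => ⟨inclC0 G (f s), inclC0_mem (f s)⟩
  have hF : Continuous F :=
    ((ZeroAtInftyContinuousMap.isometry_toBCF (α := G) (β := ℂ)).continuous.comp
      (map_continuous f)).subtype_mk _
  have hFc : HasCompactSupport F := f.hasCompactSupport.comp_left
    (g := fun a : C₀(G, ℂ) => (⟨inclC0 G a, inclC0_mem a⟩ : Cbru G)) rfl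
  let P : ℕ → G → Cbru G := fun n s => F s * (actionCbru G).act (u s) (cutoff hd n)
  have hP : ∀ n, Continuous (P n) := fun n =>
    hF.mul (((actionCbru G).continuous_act (cutoff hd n)).comp hu)
  have hPc : ∀ n, HasCompactSupport (P n) := fun n => hFc.mul_right
  let g : ℕ → G → ℝ := fun n s => ‖F s - P n s‖
  have hg : ∀ n, Integrable (g n) μ := fun n =>
    (((hF.sub (hP n)).integrable_of_hasCompactSupport (hFc.sub (hPc n))).norm)
  have hlim : Tendsto (fun n => ∫ s, g n s ∂μ) atTop (𝓝 (∫ _ : G, (0 : ℝ) ∂μ)) := by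
    refine tendsto_integral_of_dominated_convergence (fun s => 2 * ‖F s‖)
      (fun n => (hg n).aestronglyMeasurable)
      ((hF.integrable_of_hasCompactSupport hFc).norm.const_mul 2)
      (fun n => Eventually.of_forall fun s => ?_)
      (Eventually.of_forall fun s => tendsto_mul_act_cutoff hd (f s) (fun _ => rfl) (u s))
    rw [Real.norm_eq_abs, abs_of_nonneg (norm_nonneg _)]
    calc ‖F s - P n s‖ ≤ ‖F s‖ + ‖F s‖ * ‖(actionCbru G).act (u s) (cutoff hd n)‖ :=
          (norm_sub_le _ _).trans (by gcongr; exact norm_mul_le _ _)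
      _ ≤ ‖F s‖ + ‖F s‖ * 1 := by
          gcongr
          exact (NonUnitalStarAlgHom.norm_apply_le _ _).trans (norm_cutoff_le hd n)
      _ = 2 * ‖F s‖ := by ring
  rw [integral_zero] at hlim
  rw [tendsto_iff_norm_sub_tendsto_zero]
  refine squeeze_zero (fun _ => norm_nonneg _) (fun n => ?_) hlim
  refine ContinuousLinearMap.opNorm_le_bound _ (integral_nonneg fun s => norm_nonneg _)
    fun ξ => ?_
  have h1 : (T n - regularRep μ (actionC0 G) (repC0 μ) f) ξ
      = -∫ s, mulOp μ (F s - P n s) (leftReg μ (L2 μ ℂ) s ξ) ∂μ := by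
    rw [_root_.sub_apply, hT, ← neg_sub, neg_inj]
    change (∫ s, mulOp μ (F s) (leftReg μ (L2 μ ℂ) s ξ) ∂μ)
      - (∫ s, mulOp μ (P n s) (leftReg μ (L2 μ ℂ) s ξ) ∂μ) = _
    rw [← integral_sub (integrable_inducedRep μ _ _ hF hFc ξ)
      (integrable_inducedRep μ _ _ (hP n) (hPc n) ξ)]
    simp only [inducedRep_sub, _root_.sub_apply]
  rw [h1, norm_neg]
  exact norm_integral_inducedRep_le μ _ _ (hg n) (fun s => le_rfl) ξ

theorem regularRep_mem_decaying (f : C_c(G, C₀(G, ℂ))) :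
    regularRep μ (actionC0 G) (repC0 μ) f ∈ decaying hd μ := by
  let f' : C_c(G, Cbru G) := ⟨⟨fun s => ⟨inclC0 G (f s), inclC0_mem (f s)⟩,
    ((ZeroAtInftyContinuousMap.isometry_toBCF (α := G) (β := ℂ)).continuous.comp
      (map_continuous f)).subtype_mk _⟩, f.hasCompactSupport.comp_left
    (g := fun a : C₀(G, ℂ) => (⟨inclC0 G a, inclC0_mem a⟩ : Cbru G)) rfl⟩
  refine ⟨tendsto_of_cutoff hd μ f id continuous_id _ fun n ξ => ?_,
    tendsto_of_cutoff hd μ f (fun _ => 1) continuous_const _ fun n ξ => ?_⟩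
  · exact regularRep_inducedRep μ (actionCbru G) (repCbru μ) (cutoff hd n) f' ξ
  · refine (inducedRep_regularRep μ (actionCbru G) (repCbru μ) (cutoff hd n) f' ξ).trans ?_
    simp only [map_one, mul_comm (cutoff hd n)]
    rfl

/-- The elements of `C_0(G) ⋊_{R,r} G` vanish at infinity, in the sense that the cutoff functions
are an approximate unit for them. -/
theorem crossedC0_le_decaying : crossedC0 μ ≤ decaying hd μ :=
  NonUnitalStarSubalgebra.topologicalClosure_minimal _
    (NonUnitalStarAlgebra.adjoin_le (by rintro _ ⟨f, rfl⟩; exact regularRep_mem_decaying hd μ f))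
    (isClosed_decaying hd μ)

/-- The multiplication operators by the cutoff functions jointly separate points. -/
theorem eq_zero_of_mulOp_cutoff {ξ : L2 μ (L2 μ ℂ)} (h : ∀ n, mulOp μ (cutoff hd n) ξ = 0) :
    ξ = 0 := by
  ext1
  have h1 : ∀ᵐ t ∂μ, ∀ n, mulRep μ (rightTranslate t⁻¹ (cutoff hd n : G →ᵇ ℂ)) (ξ t) = 0 := by
    rw [ae_all_iff]
    intro n
    have h2 := mulOp_coe μ (cutoff hd n) ξ
    rw [h n] at h2
    filter_upwards [h2, Lp.coeFn_zero (L2 μ ℂ) 2 μ] with t h3 h4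
    rw [← h3, h4]
    rfl
  filter_upwards [h1, Lp.coeFn_zero (L2 μ ℂ) 2 μ] with t h2 h3
  rw [h3]
  change ξ t = 0
  ext1
  have h4 : ∀ᵐ x ∂μ, ∀ n, (cutoff hd n : G →ᵇ ℂ) (x * t⁻¹) * (ξ t) x = 0 := by
    rw [ae_all_iff]
    intro n
    have h5 := mulRep_coe μ (rightTranslate t⁻¹ (cutoff hd n : G →ᵇ ℂ)) (ξ t)
    rw [h2 n] at h5
    filter_upwards [h5, Lp.coeFn_zero ℂ 2 μ] with x h6 h7
    rw [h7] at h6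
    exact h6.symm
  filter_upwards [h4, Lp.coeFn_zero ℂ 2 μ] with x h5 h6
  obtain ⟨n, hn⟩ := exists_nat_ge (dist 1 (x * t⁻¹))
  have h7 := h5 n
  rw [cutoff_eq_one hd hn, one_mul] at h7
  rw [h7, h6]
  rfl

end Propagation

/-! ### Bump functions on the lattice and the associated kernels -/

section Ell2

variable {X : Type*}

open Classical in
theorem single_eq_smul_basisVec (x : X) (c : ℂ) :
    (lp.single 2 x c : Ell2 X) = c • (basisVec x : Ell2 X) := by
  have := lp.single_smul (E := fun _ : X => ℂ) (𝕜 := ℂ) 2 x c (1 : ℂ)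
  rw [smul_eq_mul, mul_one] at this
  rw [this, basisVec]

theorem hasSum_basisVec (v : Ell2 X) : HasSum (fun x => v x • (basisVec x : Ell2 X)) v := by
  classical
  have := lp.hasSum_single (p := 2) (by simp) v
  simpa only [single_eq_smul_basisVec] using this

theorem inner_basisVec_left (x : X) (v : Ell2 X) : inner ℂ (basisVec x) v = v x := by
  classical
  rw [basisVec, lp.inner_single_left]
  simp

theorem basisVec_apply_self (x : X) : (basisVec x : Ell2 X) x = 1 := by
  classical
  simp [basisVec]

theorem basisVec_apply_ne {x y : X} (h : y ≠ x) : (basisVec x : Ell2 X) y = 0 := by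
  classical
  simp [basisVec, h]

theorem norm_basisVec (x : X) : ‖(basisVec x : Ell2 X)‖ = 1 := by
  classical
  rw [basisVec, lp.norm_single (by simp)]
  simp

theorem clm_eq_sum_basisVec {E : Type*} [NormedAddCommGroup E] [NormedSpace ℂ E]
    (T : Ell2 X →L[ℂ] E) (F : Finset X) (h : ∀ x ∉ F, T (basisVec x) = 0) (v : Ell2 X) :
    T v = ∑ x ∈ F, v x • T (basisVec x) := by
  have h1 := T.hasSum (hasSum_basisVec v)
  simp only [map_smul] at h1
  exact h1.unique (hasSum_sum_of_ne_finset_zero fun x hx => by rw [h x hx, smul_zero])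

theorem norm_le_card_mul_of_support {F : Finset X} {v : Ell2 X} (h : ∀ x ∉ F, v x = 0) {C : ℝ}
    (hC : ∀ x, ‖v x‖ ≤ C) : ‖v‖ ≤ F.card * C := by
  have h1 : v = ∑ x ∈ F, v x • (basisVec x : Ell2 X) :=
    (hasSum_basisVec v).unique (hasSum_sum_of_ne_finset_zero fun x hx => by
      rw [h x hx, zero_smul])
  conv_lhs => rw [h1]
  rw [← nsmul_eq_mul, ← Finset.sum_const]
  refine norm_sum_le_of_le F fun x _ => ?_
  rw [norm_smul, norm_basisVec, mul_one]
  exact hC x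

end Ell2

section Bump

variable {G : Type*} [Group G] [MetricSpace G] [IsTopologicalGroup G]

/-- The bump function `y ↦ κ (r - d(z, y))₊` around `z`. -/
def bump (r κ : ℝ) (z y : G) : ℝ := κ * max 0 (r - dist z y)

variable {r κ : ℝ}

theorem bump_nonneg (hκ : 0 ≤ κ) (z y : G) : 0 ≤ bump r κ z y :=
  mul_nonneg hκ (le_max_left _ _)

theorem bump_le (hr : 0 ≤ r) (hκ : 0 ≤ κ) (z y : G) : bump r κ z y ≤ κ * r :=
  mul_le_mul_of_nonneg_left (max_le hr (by linarith [dist_nonneg (x := z) (y := y)])) hκ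

theorem bump_eq_zero {z y : G} (h : r ≤ dist z y) : bump r κ z y = 0 := by
  rw [bump, max_eq_left (by linarith), mul_zero]

theorem dist_lt_of_bump_ne_zero {z y : G} (h : bump r κ z y ≠ 0) : dist z y < r := by
  by_contra hcon
  exact h (bump_eq_zero (not_lt.1 hcon))

theorem abs_bump_sub_le (hκ : 0 ≤ κ) (z x y : G) :
    |bump r κ z x - bump r κ z y| ≤ κ * dist x y := by
  rw [bump, bump, ← mul_sub, abs_mul, abs_of_nonneg hκ]
  gcongr
  refine (abs_max_sub_max_le_max _ _ _ _).trans ?_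
  rw [sub_self, abs_zero, max_eq_right (abs_nonneg _)]
  have := abs_dist_sub_le y x z
  rw [dist_comm y z, dist_comm x z, dist_comm y x] at this
  calc _ = |dist z y - dist z x| := by congr 1; ring
    _ ≤ _ := this

theorem bump_mul_left (hd : ∀ g x y : G, dist (g * x) (g * y) = dist x y) (z y : G) :
    bump r κ z y = bump r κ 1 (z⁻¹ * y) := by
  have := hd z⁻¹ z y
  rw [inv_mul_cancel] at this
  rw [bump, bump, this]

theorem continuous_bump (z : G) : Continuous (bump r κ z) := by
  unfold bump
  fun_prop

/-- The bump function around `z` as an element of `C_b^{ru}(G)`. -/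
def bumpCbru (hd : ∀ g x y : G, dist (g * x) (g * y) = dist x y) (hr : 0 ≤ r) (hκ : 0 ≤ κ)
    (z : G) : Cbru G :=
  lipschitzCbru hd (fun y => (bump r κ z y : ℂ)) κ (κ * r)
    (fun x y => by
      rw [← Complex.ofReal_sub, Complex.norm_real]
      exact abs_bump_sub_le hκ z x y)
    (fun x => by
      rw [Complex.norm_real, Real.norm_eq_abs, abs_of_nonneg (bump_nonneg hκ _ _)]
      exact bump_le hr hκ _ _)

variable {Z : Set G}

/-- The bump functions around the points of a `2r`-separated set have disjoint supports. -/
theorem exists_card_le_one_bump (hsep : ∀ z w : Z, z ≠ w → 2 * r < dist (z : G) w) (y : G) :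
    ∃ F : Finset Z, F.card ≤ 1 ∧ ∀ z ∉ F, bump r κ (z : G) y = 0 := by
  classical
  by_cases h : ∃ z : Z, dist (z : G) y < r
  · obtain ⟨z, hz⟩ := h
    refine ⟨{z}, by simp, fun w hw => bump_eq_zero ?_⟩
    rw [Finset.mem_singleton] at hw
    by_contra hcon
    push Not at hcon
    have h1 := hsep w z hw
    have h2 := dist_triangle (w : G) y z
    rw [dist_comm y] at h2
    linarith
  · push Not at h
    exact ⟨∅, by simp, fun w _ => bump_eq_zero (h w)⟩

/-- The vector `Ω(y) = ∑_z φ_z(y) δ_z` of `ℓ²(Z)`; the sum has at most one non-zero term. -/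
def omega (r κ : ℝ) {Z : Set G} (hsep : ∀ z w : Z, z ≠ w → 2 * r < dist (z : G) w) (y : G) :
    Ell2 Z :=
  ⟨fun z => (bump r κ (z : G) y : ℂ), by
    obtain ⟨F, _, hF⟩ := exists_card_le_one_bump (κ := κ) hsep y
    refine memℓp_gen (summable_of_ne_finset_zero (s := F) fun z hz => ?_)
    simp [hF z hz]⟩

variable (hsep : ∀ z w : Z, z ≠ w → 2 * r < dist (z : G) w)

theorem omega_apply (y : G) (z : Z) : omega r κ hsep y z = (bump r κ (z : G) y : ℂ) := rfl

theorem omega_eq (y : G) : omega r κ hsep y = 0 ∨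
    ∃ z : Z, dist (z : G) y < r ∧
      omega r κ hsep y = (bump r κ (z : G) y : ℂ) • (basisVec z : Ell2 Z) := by
  by_cases h : ∃ z : Z, bump r κ (z : G) y ≠ 0
  · obtain ⟨z, hz⟩ := h
    have hzy := dist_lt_of_bump_ne_zero hz
    refine Or.inr ⟨z, hzy, ?_⟩
    ext w
    by_cases hw : w = z
    · subst hw
      rw [omega_apply, lp.coeFn_smul, Pi.smul_apply, basisVec_apply_self, smul_eq_mul, mul_one]
    · rw [omega_apply]
      have h1 : bump r κ (w : G) y = 0 := bump_eq_zero <| by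
        by_contra hcon
        push Not at hcon
        have h1 := hsep w z hw
        have h2 := dist_triangle (w : G) y z
        rw [dist_comm y] at h2
        linarith
      rw [h1, lp.coeFn_smul, Pi.smul_apply, basisVec_apply_ne hw, smul_zero, Complex.ofReal_zero]
  · push Not at h
    left
    ext w
    rw [omega_apply, h w]
    rfl

theorem norm_omega_le (hr : 0 ≤ r) (hκ : 0 ≤ κ) (y : G) : ‖omega r κ hsep y‖ ≤ κ * r := by
  obtain ⟨F, hF1, hF⟩ := exists_card_le_one_bump (κ := κ) hsep y
  have h1 : ‖omega r κ hsep y‖ ≤ F.card * (κ * r) :=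
    norm_le_card_mul_of_support (fun z hz => by rw [omega_apply, hF z hz]; rfl) fun z => by
      rw [omega_apply, Complex.norm_real, Real.norm_eq_abs, abs_of_nonneg (bump_nonneg hκ _ _)]
      exact bump_le hr hκ _ _
  have h2 : (F.card : ℝ) ≤ 1 := by exact_mod_cast hF1
  exact h1.trans (mul_le_of_le_one_left (by positivity) h2)

/-- `Ω` is Lipschitz: at most two coordinates of `Ω(x) - Ω(y)` are non-zero. -/
theorem norm_omega_sub_le (hκ : 0 ≤ κ) (x y : G) :
    ‖omega r κ hsep x - omega r κ hsep y‖ ≤ 2 * κ * dist x y := by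
  classical
  obtain ⟨F, hF1, hF⟩ := exists_card_le_one_bump (κ := κ) hsep x
  obtain ⟨F', hF1', hF'⟩ := exists_card_le_one_bump (κ := κ) hsep y
  have h1 : ‖omega r κ hsep x - omega r κ hsep y‖ ≤ (F ∪ F').card * (κ * dist x y) :=
    norm_le_card_mul_of_support
      (fun z hz => by
        rw [Finset.mem_union, not_or] at hz
        rw [lp.coeFn_sub, Pi.sub_apply, omega_apply, omega_apply, hF z hz.1, hF' z hz.2, sub_self])
      fun z => by
        rw [lp.coeFn_sub, Pi.sub_apply, omega_apply, omega_apply, ← Complex.ofReal_sub,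
          Complex.norm_real]
        exact abs_bump_sub_le hκ _ _ _
  have h2 : ((F ∪ F').card : ℝ) ≤ 2 := by
    exact_mod_cast (Finset.card_union_le F F').trans (by omega)
  calc _ ≤ _ := h1
    _ ≤ 2 * (κ * dist x y) := by gcongr
    _ = _ := by ring

/-- The kernel `(x, y) ↦ ⟨Ω(x), a Ω(y)⟩` on `G` of the operator `∑ a_{z,w} φ_z ⊗ φ_w` on `L²(G)`
that an operator `a` on `ℓ²(Z)` defines. -/
def kern (κ : ℝ) (a : Ell2 Z →L[ℂ] Ell2 Z) (x y : G) : ℂ :=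
  inner ℂ (omega r κ hsep x) (a (omega r κ hsep y))

theorem norm_kern_le (hr : 0 ≤ r) (hκ : 0 ≤ κ) (a : Ell2 Z →L[ℂ] Ell2 Z) (x y : G) :
    ‖kern hsep κ a x y‖ ≤ κ * r * (‖a‖ * (κ * r)) := by
  refine (norm_inner_le_norm _ _).trans ?_
  gcongr
  · exact norm_omega_le hsep hr hκ x
  · exact (a.le_opNorm _).trans (by gcongr; exact norm_omega_le hsep hr hκ y)

theorem norm_kern_sub_le (hr : 0 ≤ r) (hκ : 0 ≤ κ) (a : Ell2 Z →L[ℂ] Ell2 Z) (x y x' y' : G) :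
    ‖kern hsep κ a x y - kern hsep κ a x' y'‖
      ≤ 2 * κ * ‖a‖ * (κ * r) * (dist x x' + dist y y') := by
  have e : kern hsep κ a x y - kern hsep κ a x' y'
      = inner ℂ (omega r κ hsep x - omega r κ hsep x') (a (omega r κ hsep y))
        + inner ℂ (omega r κ hsep x') (a (omega r κ hsep y - omega r κ hsep y')) := by
    rw [kern, kern, map_sub, inner_sub_left, inner_sub_right]
    ring
  rw [e]
  calc _ ≤ (2 * κ * dist x x') * (‖a‖ * (κ * r)) + (κ * r) * (‖a‖ * (2 * κ * dist y y')) := by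
        refine (norm_add_le _ _).trans (add_le_add ?_ ?_)
        · refine (norm_inner_le_norm _ _).trans ?_
          gcongr
          · exact norm_omega_sub_le hsep hκ x x'
          · exact (a.le_opNorm _).trans (by gcongr; exact norm_omega_le hsep hr hκ y)
        · refine (norm_inner_le_norm _ _).trans ?_
          gcongr
          · exact norm_omega_le hsep hr hκ x'
          · exact (a.le_opNorm _).trans (by gcongr; exact norm_omega_sub_le hsep hκ y y')
    _ = _ := by ring

theorem exists_entry_of_kern_ne_zero {a : Ell2 Z →L[ℂ] Ell2 Z} {x y : G}
    (h : kern hsep κ a x y ≠ 0) :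
    ∃ z w : Z, dist (z : G) x < r ∧ dist (w : G) y < r ∧ entry a z w ≠ 0 := by
  rw [kern] at h
  rcases omega_eq hsep (κ := κ) x with hx | ⟨z, hz, hx⟩
  · rw [hx, inner_zero_left] at h
    exact absurd rfl h
  rcases omega_eq hsep (κ := κ) y with hy | ⟨w, hw, hy⟩
  · rw [hy, map_zero, inner_zero_right] at h
    exact absurd rfl h
  have e : kern hsep κ a x y = entry a z w * (bump r κ (z : G) x * bump r κ (w : G) y) := by
    rw [kern, hx, hy, map_smul, inner_smul_left, inner_smul_right, Complex.conj_ofReal, entry]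
    ring
  refine ⟨z, w, hz, hw, fun h0 => h ?_⟩
  rw [h0, zero_mul] at e
  exact e

variable (hd : ∀ g x y : G, dist (g * x) (g * y) = dist x y)

include hd in
theorem dist_mul_self_left (y s : G) : dist y (y * s) = dist 1 s := by
  have := hd y 1 s
  rwa [mul_one] at this

/-- The function `y ↦ ⟨Ω(y), a Ω(ys)⟩`. -/
def kernCbru (hr : 0 ≤ r) (hκ : 0 ≤ κ) (a : Ell2 Z →L[ℂ] Ell2 Z) (s : G) : Cbru G :=
  ⟨BoundedContinuousFunction.ofNormedAddCommGroup (fun y => kern hsep κ a y (y * s))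
    (by
      rw [continuous_iff_continuousAt]
      intro y
      rw [ContinuousAt, tendsto_iff_norm_sub_tendsto_zero]
      refine squeeze_zero (fun _ => norm_nonneg _)
        (fun x => norm_kern_sub_le hsep hr hκ a x (x * s) y (y * s)) ?_
      have : Continuous fun x => 2 * κ * ‖a‖ * (κ * r) * (dist x y + dist (x * s) (y * s)) := by
        fun_prop
      simpa using this.tendsto y)
    (κ * r * (‖a‖ * (κ * r))) (fun y => norm_kern_le hsep hr hκ a _ _), by
    intro ε hε
    have h : Tendsto (fun g : G => 2 * κ * ‖a‖ * (κ * r) * (dist g 1 + dist (g * s) s))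
        (𝓝 1) (𝓝 0) := by
      have : Continuous fun g : G =>
        2 * κ * ‖a‖ * (κ * r) * (dist g 1 + dist (g * s) s) := by fun_prop
      simpa using this.tendsto 1
    filter_upwards [h.eventually (gt_mem_nhds hε)] with g hg x
    refine (norm_kern_sub_le hsep hr hκ a (x * g) (x * g * s) x (x * s)).trans ?_
    rw [mul_assoc x g s, hd, dist_comm (x * g) x, dist_mul_self_left hd, dist_comm 1 g]
    exact hg.le⟩

theorem kernCbru_apply (hr : 0 ≤ r) (hκ : 0 ≤ κ) (a : Ell2 Z →L[ℂ] Ell2 Z) (s y : G) :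
    (kernCbru hsep hd hr hκ a s : G →ᵇ ℂ) y = kern hsep κ a y (y * s) := rfl

theorem continuous_kernCbru (hr : 0 ≤ r) (hκ : 0 ≤ κ) (a : Ell2 Z →L[ℂ] Ell2 Z) :
    Continuous (kernCbru hsep hd hr hκ a) := by
  have : LipschitzWith (2 * κ * ‖a‖ * (κ * r)).toNNReal (kernCbru hsep hd hr hκ a) := by
    refine LipschitzWith.of_dist_le_mul fun s t => ?_
    rw [Subtype.dist_eq]
    refine (BoundedContinuousFunction.dist_le (by positivity)).2 fun y => ?_
    rw [dist_eq_norm, Real.coe_toNNReal _ (by positivity)]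
    refine (norm_kern_sub_le hsep hr hκ a y (y * s) y (y * t)).trans ?_
    rw [dist_self, zero_add, hd]
  exact this.continuous

theorem kernCbru_eq_zero (hr : 0 ≤ r) (hκ : 0 ≤ κ) {a : Ell2 Z →L[ℂ] Ell2 Z} {R : ℝ}
    (ha : PropagationLE a R) {s : G} (hs : R + 2 * r < dist 1 s) :
    kernCbru hsep hd hr hκ a s = 0 := by
  ext y
  rw [kernCbru_apply]
  by_contra h
  obtain ⟨z, w, hz, hw, hzw⟩ := exists_entry_of_kern_ne_zero hsep h
  have h1 : dist (z : G) w ≤ R := ha z w hzw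
  have h2 := dist_triangle4 y z w (y * s)
  rw [dist_mul_self_left hd, dist_comm y] at h2
  linarith

variable [ProperSpace G]

theorem hasCompactSupport_kernCbru (hr : 0 ≤ r) (hκ : 0 ≤ κ) {a : Ell2 Z →L[ℂ] Ell2 Z} {R : ℝ}
    (ha : PropagationLE a R) : HasCompactSupport (kernCbru hsep hd hr hκ a) :=
  HasCompactSupport.intro (isCompact_closedBall (1 : G) (R + 2 * r)) fun s hs =>
    kernCbru_eq_zero hsep hd hr hκ ha (by
      rw [Metric.mem_closedBall, not_le, dist_comm] at hs
      exact hs)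

variable [MeasurableSpace G] [BorelSpace G]

/-- The element `s ↦ Δ(s)^{1/2} ⟨Ω(·), a Ω(· s)⟩` of `C_c(G, C_b^{ru}(G))`; its image under the
regular representation is the transport of `a`, up to the constant `invConst`. -/
def kernCc (hr : 0 ≤ r) (hκ : 0 ≤ κ) {a : Ell2 Z →L[ℂ] Ell2 Z} {R : ℝ}
    (ha : PropagationLE a R) : C_c(G, Cbru G) :=
  ⟨⟨fun s => ((Real.sqrt (modular s) : ℝ) : ℂ) • kernCbru hsep hd hr hκ a s,
    (by fun_prop : Continuous fun s : G => ((Real.sqrt (modular s) : ℝ) : ℂ)).smul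
      (continuous_kernCbru hsep hd hr hκ a)⟩,
    (hasCompactSupport_kernCbru hsep hd hr hκ ha).mono fun s hs h0 => hs (by
      have h1 : kernCbru hsep hd hr hκ a s = 0 := h0
      change ((Real.sqrt (modular s) : ℝ) : ℂ) • kernCbru hsep hd hr hκ a s = 0
      rw [h1, smul_zero])⟩

theorem kernCc_apply (hr : 0 ≤ r) (hκ : 0 ≤ κ) {a : Ell2 Z →L[ℂ] Ell2 Z} {R : ℝ}
    (ha : PropagationLE a R) (s y : G) : (kernCc hsep hd hr hκ ha s : G →ᵇ ℂ) y
      = ((Real.sqrt (modular s) : ℝ) : ℂ) * kern hsep κ a y (y * s) := rfl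

/-- If only finitely many rows of `a` are non-zero, the associated convolution element has
coefficients in `C_0(G)`. -/
theorem exists_kernC0 (hr : 0 ≤ r) (hκ : 0 ≤ κ) {a : Ell2 Z →L[ℂ] Ell2 Z} {R : ℝ}
    (ha : PropagationLE a R) (F : Finset Z) (hF : ∀ z w, entry a z w ≠ 0 → z ∈ F) :
    ∃ f : C_c(G, C₀(G, ℂ)), ∀ s,
      (⟨inclC0 G (f s), inclC0_mem (f s)⟩ : Cbru G) = kernCc hsep hd hr hκ ha s := by
  have hsupp : ∀ s, HasCompactSupport (kernCc hsep hd hr hκ ha s : G →ᵇ ℂ) := by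
    intro s
    refine HasCompactSupport.intro
      (F.finite_toSet.isCompact_biUnion fun z _ => isCompact_closedBall (z : G) r) fun y hy => ?_
    rw [kernCc_apply]
    by_contra h
    obtain ⟨z, w, hz, hw, hzw⟩ := exists_entry_of_kern_ne_zero hsep (right_ne_zero_of_mul h)
    refine hy (Set.mem_biUnion (hF z w hzw) ?_)
    rw [Metric.mem_closedBall, dist_comm]
    exact hz.le
  let f₀ : G → C₀(G, ℂ) := fun s =>
    ⟨⟨kernCc hsep hd hr hκ ha s, (kernCc hsep hd hr hκ ha s : G →ᵇ ℂ).continuous⟩,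
      (hsupp s).is_zero_at_infty⟩
  have hf₀ : Continuous f₀ := by
    rw [(ZeroAtInftyContinuousMap.isometry_toBCF (α := G) (β := ℂ)).isEmbedding.continuous_iff]
    exact continuous_subtype_val.comp (map_continuous (kernCc hsep hd hr hκ ha))
  refine ⟨⟨⟨f₀, hf₀⟩, (kernCc hsep hd hr hκ ha).hasCompactSupport.mono fun s hs h0 => hs ?_⟩,
    fun s => rfl⟩
  ext y
  change (kernCc hsep hd hr hκ ha s : G →ᵇ ℂ) y = 0
  have h0' : kernCc hsep hd hr hκ ha s = 0 := h0
  rw [h0']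
  rfl

end Bump

/-! ### The isometries attached to lattice points -/

section Isometries

variable {G : Type*} [Group G] [MetricSpace G] [IsTopologicalGroup G] [ProperSpace G]
  [MeasurableSpace G] [BorelSpace G] (μ : Measure G) [μ.IsHaarMeasure]

/-- The operator of multiplication by `x ↦ h(x t⁻¹)` on `L²(G)`. -/
def fibreOp (h : Cbru G) (t : G) : L2 μ ℂ →L[ℂ] L2 μ ℂ :=
  mulRep μ (rightTranslate t⁻¹ (h : G →ᵇ ℂ))

theorem continuous_fibreOp (h : Cbru G) : Continuous (fibreOp μ h) :=
  (map_continuous (mulRep μ)).comp ((continuous_rightTranslate h.2).comp continuous_inv)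

theorem fibreOp_coe (h : Cbru G) (t : G) (η : L2 μ ℂ) :
    fibreOp μ h t η =ᵐ[μ] fun x => (h : G →ᵇ ℂ) (x * t⁻¹) * η x :=
  mulRep_coe μ _ η

theorem fibreOp_inner_left (h : Cbru G) (t : G) (η ζ : L2 μ ℂ) :
    inner ℂ (fibreOp μ h t η) ζ = inner ℂ η (fibreOp μ (star h) t ζ) := by
  have e : fibreOp μ (star h) t = star (fibreOp μ h t) := by
    rw [fibreOp, fibreOp, ← map_star]
    rfl
  rw [e, ContinuousLinearMap.star_eq_adjoint, ContinuousLinearMap.adjoint_inner_right]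

theorem fibreOp_mul (h k : Cbru G) (t : G) :
    fibreOp μ (h * k) t = fibreOp μ h t * fibreOp μ k t := by
  rw [fibreOp, fibreOp, fibreOp, ← map_mul]
  rfl

theorem fibreOp_zero (t : G) : fibreOp μ 0 t = 0 := map_zero (mulRep μ)

theorem enorm_sq_eq_lintegral {α E : Type*} [MeasurableSpace α] {ν : Measure α}
    [NormedAddCommGroup E] (f : Lp E 2 ν) : ‖f‖ₑ ^ 2 = ∫⁻ x, ‖f x‖ₑ ^ 2 ∂ν := by
  have h := eLpNorm_nnreal_pow_eq_lintegral (p := 2) (μ := ν) (f := f) (by norm_num)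
  rw [Lp.enorm_def]
  simpa using h

/-- The function `t ↦ Δ(t)^{1/2} M(R_{t⁻¹} h) η` with values in `L²(G)`. -/
def spread (h : Cbru G) (η : L2 μ ℂ) (t : G) : L2 μ ℂ :=
  ((Real.sqrt (modular t) : ℝ) : ℂ) • fibreOp μ h t η

theorem continuous_spread (h : Cbru G) (η : L2 μ ℂ) : Continuous (spread μ h η) :=
  (by fun_prop : Continuous fun t : G => ((Real.sqrt (modular t) : ℝ) : ℂ)).smul
    ((continuous_fibreOp μ h).clm_apply continuous_const)

/-- The norm of `t ↦ Δ(t)^{1/2} M(R_{t⁻¹} h) η` in `L²(G, L²(G))`, by Tonelli's theorem and the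
invariance of `Δ(t) dt` under right translations. -/
theorem lintegral_enorm_spread_sq (h : Cbru G) (η : L2 μ ℂ) :
    ∫⁻ t, ‖spread μ h η t‖ₑ ^ 2 ∂μ
      = ENNReal.ofReal (invConst μ) * (∫⁻ y, ‖(h : G →ᵇ ℂ) y‖ₑ ^ 2 ∂μ) * ‖η‖ₑ ^ 2 := by
  have hη : Measurable η := (Lp.stronglyMeasurable η).measurable
  have hh : Continuous (h : G →ᵇ ℂ) := (h : G →ᵇ ℂ).continuous
  have h1 : ∀ t, ‖spread μ h η t‖ₑ ^ 2
      = ∫⁻ x, ENNReal.ofReal (modular t) * (‖(h : G →ᵇ ℂ) (x * t⁻¹)‖ₑ ^ 2 * ‖η x‖ₑ ^ 2) ∂μ := by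
    intro t
    have e : ‖((Real.sqrt (modular t) : ℝ) : ℂ)‖ₑ ^ 2 = ENNReal.ofReal (modular t) := by
      rw [← ofReal_norm, ← ENNReal.ofReal_pow (norm_nonneg _), Complex.norm_real,
        Real.norm_eq_abs, sq_abs, Real.sq_sqrt (modular_pos t).le]
    rw [spread, enorm_smul, mul_pow, e, enorm_sq_eq_lintegral, ← lintegral_const_mul']
    · refine lintegral_congr_ae ?_
      filter_upwards [fibreOp_coe μ h t η] with x hx
      rw [hx, enorm_mul, mul_pow]
    · exact ENNReal.ofReal_ne_top
  simp only [h1]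
  rw [lintegral_lintegral_swap]
  · have h2 : ∀ x, ∫⁻ t, ENNReal.ofReal (modular t) *
        (‖(h : G →ᵇ ℂ) (x * t⁻¹)‖ₑ ^ 2 * ‖η x‖ₑ ^ 2) ∂μ
        = ENNReal.ofReal (invConst μ) * (∫⁻ y, ‖(h : G →ᵇ ℂ) y‖ₑ ^ 2 ∂μ) * ‖η x‖ₑ ^ 2 := by
      intro x
      rw [← lintegral_modular_mul_mul_inv μ (f := fun y => ‖(h : G →ᵇ ℂ) y‖ₑ ^ 2) (by fun_prop) x,
        ← lintegral_mul_const']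
      · simp only [mul_assoc]
      · simp
    simp only [h2]
    rw [lintegral_const_mul _ (by fun_prop), enorm_sq_eq_lintegral]
  · have hc : Continuous fun p : G × G => (h : G →ᵇ ℂ) (p.2 * p.1⁻¹) := by fun_prop
    have hm : Measurable fun p : G × G => (h : G →ᵇ ℂ) (p.2 * p.1⁻¹) := hc.measurable
    have hm2 : Measurable fun p : G × G => modular p.1 :=
      (continuous_modular.comp continuous_fst).measurable
    refine Measurable.aemeasurable ?_
    unfold Function.uncurry
    fun_prop

variable {μ}

/-- The normalisation of `h` under which `η ↦ (t ↦ Δ(t)^{1/2} M(R_{t⁻¹} h) η)` is isometric. -/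
def IsNormalized (μ : Measure G) [μ.IsHaarMeasure] (h : Cbru G) : Prop :=
  ENNReal.ofReal (invConst μ) * (∫⁻ y, ‖(h : G →ᵇ ℂ) y‖ₑ ^ 2 ∂μ) = 1

theorem eLpNorm_spread {h : Cbru G} (hh : IsNormalized μ h) (η : L2 μ ℂ) :
    eLpNorm (spread μ h η) 2 μ = ‖η‖ₑ := by
  have h1 := eLpNorm_nnreal_pow_eq_lintegral (p := 2) (μ := μ) (f := spread μ h η) (by norm_num)
  have h2 : eLpNorm (spread μ h η) 2 μ ^ 2 = ‖η‖ₑ ^ 2 := by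
    rw [← one_mul (‖η‖ₑ ^ 2), ← hh, ← lintegral_enorm_spread_sq]
    simpa using h1
  exact (ENNReal.pow_right_strictMono two_ne_zero).injective h2

theorem memLp_spread {h : Cbru G} (hh : IsNormalized μ h) (η : L2 μ ℂ) :
    MemLp (spread μ h η) 2 μ :=
  ⟨(continuous_spread μ h η).aestronglyMeasurable, by rw [eLpNorm_spread hh]; simp⟩

/-- The isometry `L²(G) → L²(G, L²(G))`, `η ↦ (t ↦ Δ(t)^{1/2} M(R_{t⁻¹} h) η)`. -/
def spreadIsometry {h : Cbru G} (hh : IsNormalized μ h) : L2 μ ℂ →ₗᵢ[ℂ] L2 μ (L2 μ ℂ) where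
  toFun η := (memLp_spread hh η).toLp
  map_add' η ζ := by
    rw [← MemLp.toLp_add]
    congr 1
    ext1 t
    simp [spread]
  map_smul' c η := by
    rw [RingHom.id_apply, ← MemLp.toLp_const_smul]
    congr 1
    ext1 t
    simp only [spread, map_smul, Pi.smul_apply]
    exact smul_comm _ _ _
  norm_map' η := by
    change ‖(memLp_spread hh η).toLp‖ = _
    rw [Lp.norm_toLp, eLpNorm_spread hh]
    simp

theorem spreadIsometry_coe {h : Cbru G} (hh : IsNormalized μ h) (η : L2 μ ℂ) :
    spreadIsometry hh η =ᵐ[μ] spread μ h η := (memLp_spread hh η).coeFn_toLp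

theorem inner_spreadIsometry {h k : Cbru G} (hh : IsNormalized μ h) (hk : IsNormalized μ k)
    (hhk : star h * k = 0) (η ζ : L2 μ ℂ) :
    inner ℂ (spreadIsometry hh η) (spreadIsometry hk ζ) = 0 := by
  rw [MeasureTheory.L2.inner_def]
  refine integral_eq_zero_of_ae ?_
  filter_upwards [spreadIsometry_coe hh η, spreadIsometry_coe hk ζ] with t h1 h2
  rw [h1, h2, spread, spread, inner_smul_left, inner_smul_right, fibreOp_inner_left,
    ← _root_.mul_apply_eq_comp, ← fibreOp_mul, hhk, fibreOp_zero]
  simp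

theorem mulOp_spreadIsometry {h k : Cbru G} (hh : IsNormalized μ h) (hkh : k * h = 0)
    (η : L2 μ ℂ) : mulOp μ k (spreadIsometry hh η) = 0 := by
  ext1
  filter_upwards [mulOp_coe μ k (spreadIsometry hh η), spreadIsometry_coe hh η,
    Lp.coeFn_zero (L2 μ ℂ) 2 μ] with t h1 h2 h3
  rw [h1, h2, h3, spread, map_smul]
  change _ • (fibreOp μ k t) (fibreOp μ h t η) = _
  rw [← _root_.mul_apply_eq_comp, ← fibreOp_mul, hkh, fibreOp_zero]
  simp

theorem mulOp_spreadIsometry_self {h k : Cbru G} (hh : IsNormalized μ h) (hkh : k * h = h)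
    (η : L2 μ ℂ) : mulOp μ k (spreadIsometry hh η) = spreadIsometry hh η := by
  ext1
  filter_upwards [mulOp_coe μ k (spreadIsometry hh η), spreadIsometry_coe hh η] with t h1 h2
  rw [h1, h2, spread, map_smul]
  change _ • (fibreOp μ k t) (fibreOp μ h t η) = _
  rw [← _root_.mul_apply_eq_comp, ← fibreOp_mul, hkh]

theorem integrable_sqrt_modular_smul_fibreOp (h : Cbru G) {u : G → L2 μ ℂ} (hu : Continuous u)
    (huc : HasCompactSupport u) :
    Integrable (fun t => ((Real.sqrt (modular t) : ℝ) : ℂ) • fibreOp μ h t (u t)) μ := by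
  refine Continuous.integrable_of_hasCompactSupport ?_ ?_
  · exact (by fun_prop : Continuous fun t : G => ((Real.sqrt (modular t) : ℝ) : ℂ)).smul
      ((continuous_fibreOp μ h).clm_apply hu)
  · refine huc.mono fun t ht h0 => ht ?_
    simp [h0]

/-- The adjoint of the isometry, evaluated on a continuous function of compact support. -/
theorem adjoint_spreadIsometry {h : Cbru G} (hh : IsNormalized μ h) {u : G → L2 μ ℂ}
    (hu : Continuous u) (huc : HasCompactSupport u) (hu2 : MemLp u 2 μ) :
    ContinuousLinearMap.adjoint (spreadIsometry hh).toContinuousLinearMap hu2.toLp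
      = ∫ t, ((Real.sqrt (modular t) : ℝ) : ℂ) • fibreOp μ (star h) t (u t) ∂μ := by
  refine ext_inner_left ℂ fun η => ?_
  rw [ContinuousLinearMap.adjoint_inner_right,
    ← integral_inner (integrable_sqrt_modular_smul_fibreOp (star h) hu huc),
    MeasureTheory.L2.inner_def]
  refine integral_congr_ae ?_
  filter_upwards [spreadIsometry_coe hh η, hu2.coeFn_toLp] with t h1 h2
  change inner ℂ (spreadIsometry hh η t) _ = _
  rw [h1, h2, spread, inner_smul_left, inner_smul_right, fibreOp_inner_left, Complex.conj_ofReal]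

theorem dense_continuous_compactSupport {E : Type*} [NormedAddCommGroup E] [NormedSpace ℝ E] :
    Dense {ξ : Lp E 2 μ | ∃ (u : G → E) (hu : MemLp u 2 μ), Continuous u ∧ HasCompactSupport u ∧
      ξ = hu.toLp} := by
  intro ξ
  rw [EMetric.mem_closure_iff]
  intro ε hε
  obtain ⟨δ, hδ0, hδ⟩ := exists_between hε
  obtain ⟨u, huc, hle, hu, hu2⟩ :=
    (Lp.memLp ξ).exists_hasCompactSupport_eLpNorm_sub_le ENNReal.ofNat_ne_top hδ0.ne'
  refine ⟨hu2.toLp, ⟨u, hu2, hu, huc, rfl⟩, lt_of_le_of_lt ?_ hδ⟩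
  rw [Lp.edist_def]
  refine (eLpNorm_congr_ae ?_).trans_le hle
  filter_upwards [hu2.coeFn_toLp] with t ht
  simp [ht]

end Isometries

/-! ### Convolution elements as products of isometries -/

section RankOne

variable {G : Type*} [Group G] [MetricSpace G] [IsTopologicalGroup G] [ProperSpace G]
  [MeasurableSpace G] [BorelSpace G] {μ : Measure G} [μ.IsHaarMeasure]

theorem fibreOp_smul_mul_act (μ : Measure G) [μ.IsHaarMeasure] (c : ℂ) (h k : Cbru G) (s t : G) :
    fibreOp μ (c • (h * (actionCbru G).act s k)) t
      = c • (fibreOp μ h t * fibreOp μ k (s⁻¹ * t)) := by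
  rw [fibreOp, fibreOp, fibreOp, ← map_mul, ← map_smul]
  congr 1
  ext x
  have h1 : rightTranslate t⁻¹ ((c • (h * (actionCbru G).act s k) : Cbru G) : G →ᵇ ℂ) x
      = c * ((h : G →ᵇ ℂ) (x * t⁻¹) * (k : G →ᵇ ℂ) (x * t⁻¹ * s)) := rfl
  have h2 : (c • (rightTranslate t⁻¹ (h : G →ᵇ ℂ) * rightTranslate (s⁻¹ * t)⁻¹ (k : G →ᵇ ℂ))) x
      = c * ((h : G →ᵇ ℂ) (x * t⁻¹) * (k : G →ᵇ ℂ) (x * (s⁻¹ * t)⁻¹)) := rfl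
  rw [h1, h2, mul_inv_rev, inv_inv, mul_assoc x]

variable (μ) in
/-- Fubini's theorem and the substitution `s ↦ s⁻¹ t`, for a kernel of compact support. -/
theorem integral_sqrt_modular_mul {D : G → G → ℂ} (hD : Continuous D.uncurry) {K L : Set G}
    (hK : IsCompact K) (hL : IsCompact L) (hDK : ∀ t t', t ∉ K → D t t' = 0)
    (hDL : ∀ t t', t' ∉ L → D t t' = 0) :
    (invConst μ : ℂ) * ∫ s, ∫ t, (Real.sqrt (modular s) : ℂ) * D t (s⁻¹ * t) ∂μ ∂μ
      = ∫ t, ∫ s, (Real.sqrt (modular t) : ℂ) * (Real.sqrt (modular s) * D t s) ∂μ ∂μ := by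
  have hsq : ∀ s : G, (Real.sqrt (modular s) : ℂ) * Real.sqrt (modular s) = modular s := by
    intro s
    rw [← Complex.ofReal_mul, Real.mul_self_sqrt (modular_pos s).le]
  have hsq0 : ∀ s : G, (Real.sqrt (modular s) : ℂ) ≠ 0 := fun s => by
    exact_mod_cast (Real.sqrt_pos.2 (modular_pos s)).ne'
  have hsqc : Continuous fun s : G => ((Real.sqrt (modular s) : ℝ) : ℂ) := by fun_prop
  rw [integral_integral_swap_of_hasCompactSupport, ← integral_const_mul]
  · refine integral_congr_ae (Eventually.of_forall fun t => ?_)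
    beta_reduce
    -- `Δ(s⁻¹ t)^{-1/2} Δ(t)^{1/2} = Δ(s)^{1/2}` dictates the integrand to substitute in.
    have h1 := integral_modular_mul μ
      (f := fun s => (Real.sqrt (modular t) : ℂ) * (Real.sqrt (modular s) : ℂ)⁻¹ * D t s)
      (((hsqc.inv₀ hsq0).const_mul _).mul
        (hD.comp (by fun_prop : Continuous fun s : G => (t, s)))) t
    have h2 : ∀ s : G, (modular s : ℂ) *
        ((Real.sqrt (modular t) : ℂ) * (Real.sqrt (modular s) : ℂ)⁻¹ * D t s)
        = (Real.sqrt (modular t) : ℂ) * (Real.sqrt (modular s) * D t s) := by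
      intro s
      rw [← hsq s]
      field_simp [hsq0 s]
    have h3 : ∀ s : G, (Real.sqrt (modular t) : ℂ) * (Real.sqrt (modular (s⁻¹ * t)) : ℂ)⁻¹
        * D t (s⁻¹ * t) = (Real.sqrt (modular s) : ℂ) * D t (s⁻¹ * t) := by
      intro s
      congr 1
      rw [mul_inv_eq_iff_eq_mul₀ (hsq0 _), ← Complex.ofReal_mul,
        ← Real.sqrt_mul (modular_pos s).le, ← modular_mul, mul_inv_cancel_left]
    simp only [h2, h3] at h1
    exact h1.symm
  · have hc : Continuous fun p : G × G => D p.2 (p.1⁻¹ * p.2) :=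
      hD.comp (by fun_prop : Continuous fun p : G × G => (p.2, p.1⁻¹ * p.2))
    exact (hsqc.comp continuous_fst).mul hc
  -- The support lies in `{(s, t) | t ∈ K, s⁻¹ t ∈ L}`.
  · have hKL : IsCompact ((fun p : G × G => (p.1 * p.2⁻¹, p.1)) '' (K ×ˢ L)) :=
      (IsCompact.prod hK hL).image (by fun_prop)
    refine HasCompactSupport.intro hKL fun p hp => ?_
    have h0 : D p.2 (p.1⁻¹ * p.2) = 0 := by
      by_contra hne
      refine hp ⟨(p.2, p.1⁻¹ * p.2), ⟨?_, ?_⟩, ?_⟩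
      · by_contra hcon
        exact hne (hDK _ _ hcon)
      · by_contra hcon
        exact hne (hDL _ _ hcon)
      · ext <;> simp
    change (Real.sqrt (modular p.1) : ℂ) * D p.2 (p.1⁻¹ * p.2) = 0
    rw [h0, mul_zero]

/-- The matrix coefficients of a convolution element with coefficients `Δ(s)^{1/2} h · R_s k` between
vectors represented by functions `u`, `v`. -/
theorem inner_regularRep_toLp {h k : Cbru G} (f : C_c(G, Cbru G))
    (hf : ∀ s, f s = ((Real.sqrt (modular s) : ℝ) : ℂ) • (h * (actionCbru G).act s k))
    {u v : G → L2 μ ℂ} (hu2 : MemLp u 2 μ) (hv2 : MemLp v 2 μ) :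
    inner ℂ hv2.toLp (regularRep μ (actionCbru G) (repCbru μ) f hu2.toLp)
      = ∫ s, ∫ t, (Real.sqrt (modular s) : ℂ) *
        inner ℂ (fibreOp μ (star h) t (v t)) (fibreOp μ k (s⁻¹ * t) (u (s⁻¹ * t))) ∂μ ∂μ := by
  rw [regularRep_apply, ← integral_inner (integrable_regular μ _ _ f _)]
  refine integral_congr_ae (Eventually.of_forall fun s => ?_)
  beta_reduce
  rw [MeasureTheory.L2.inner_def]
  refine integral_congr_ae ?_
  have h0 := (measurePreserving_mul_left μ s⁻¹).quasiMeasurePreserving.ae hu2.coeFn_toLp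
  filter_upwards [mulOp_coe μ (f s) (leftReg μ (L2 μ ℂ) s hu2.toLp),
    leftReg_coe μ s hu2.toLp, hv2.coeFn_toLp, h0] with t h1 h2 h3 h4
  rw [h1, h2, h3, h4, hf]
  change inner ℂ (v t) (fibreOp μ (((Real.sqrt (modular s) : ℝ) : ℂ) •
    (h * (actionCbru G).act s k)) t (u (s⁻¹ * t))) = _
  rw [fibreOp_smul_mul_act, _root_.smul_apply, _root_.mul_apply_eq_comp, inner_smul_right,
    fibreOp_inner_left, star_star]

theorem inner_spread_adjoint_toLp {h k : Cbru G} (hh : IsNormalized μ h) (hk : IsNormalized μ k)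
    {u v : G → L2 μ ℂ} (hu : Continuous u) (huc : HasCompactSupport u) (hu2 : MemLp u 2 μ)
    (hv : Continuous v) (hvc : HasCompactSupport v) (hv2 : MemLp v 2 μ) :
    inner ℂ (ContinuousLinearMap.adjoint (spreadIsometry hh).toContinuousLinearMap hv2.toLp)
      (ContinuousLinearMap.adjoint (spreadIsometry hk).toContinuousLinearMap hu2.toLp)
      = ∫ t, ∫ s, (Real.sqrt (modular t) : ℂ) * (Real.sqrt (modular s) *
        inner ℂ (fibreOp μ (star h) t (v t)) (fibreOp μ (star k) s (u s))) ∂μ ∂μ := by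
  rw [adjoint_spreadIsometry hh hv hvc hv2, adjoint_spreadIsometry hk hu huc hu2,
    ← inner_conj_symm, ← integral_inner (integrable_sqrt_modular_smul_fibreOp (star h) hv hvc),
    ← integral_conj]
  refine integral_congr_ae (Eventually.of_forall fun t => ?_)
  beta_reduce
  rw [inner_conj_symm, ← integral_inner (integrable_sqrt_modular_smul_fibreOp (star k) hu huc)]
  refine integral_congr_ae (Eventually.of_forall fun s => ?_)
  beta_reduce
  rw [inner_smul_left, inner_smul_right, Complex.conj_ofReal]

/-- If `f(s) = Δ(s)^{1/2} h · R_s k̄`, then the regular representation maps `f` to the product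
`J_h J_k^*` of isometries, up to the inversion constant of the Haar measure. -/
theorem regularRep_eq_spread_mul_adjoint {h k : Cbru G} (hh : IsNormalized μ h)
    (hk : IsNormalized μ k) (f : C_c(G, Cbru G))
    (hf : ∀ s, f s = ((Real.sqrt (modular s) : ℝ) : ℂ) • (h * (actionCbru G).act s (star k))) :
    (invConst μ : ℂ) • regularRep μ (actionCbru G) (repCbru μ) f
      = (spreadIsometry hh).toContinuousLinearMap ∘L
        ContinuousLinearMap.adjoint (spreadIsometry hk).toContinuousLinearMap := by
  refine ContinuousLinearMap.ext fun ξ => ?_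
  refine congrFun (Continuous.ext_on dense_continuous_compactSupport
    (ContinuousLinearMap.continuous _) (ContinuousLinearMap.continuous _) ?_) ξ
  rintro _ ⟨u, hu2, hu, huc, rfl⟩
  refine ext_inner_left ℂ fun ζ => ?_
  refine congrFun (Continuous.ext_on dense_continuous_compactSupport
    (f := fun ζ : L2 μ (L2 μ ℂ) => (inner ℂ ζ _ : ℂ))
    (g := fun ζ : L2 μ (L2 μ ℂ) => (inner ℂ ζ _ : ℂ)) (by fun_prop) (by fun_prop) ?_) ζ
  rintro _ ⟨v, hv2, hv, hvc, rfl⟩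
  beta_reduce
  rw [_root_.smul_apply, inner_smul_right, inner_regularRep_toLp f hf hu2 hv2,
    ContinuousLinearMap.comp_apply, ← ContinuousLinearMap.adjoint_inner_left,
    inner_spread_adjoint_toLp hh hk hu huc hu2 hv hvc hv2]
  refine integral_sqrt_modular_mul μ (D := fun t t' =>
    inner ℂ (fibreOp μ (star h) t (v t)) (fibreOp μ (star k) t' (u t'))) ?_ hvc huc ?_ ?_
  · refine Continuous.inner (𝕜 := ℂ) ?_ ?_
    · exact ((continuous_fibreOp μ (star h)).clm_apply hv).comp continuous_fst
    · exact ((continuous_fibreOp μ (star k)).clm_apply hu).comp continuous_snd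
  · intro t t' ht
    rw [image_eq_zero_of_notMem_tsupport ht, map_zero, inner_zero_left]
  · intro t t' ht
    rw [image_eq_zero_of_notMem_tsupport ht, map_zero, inner_zero_right]

end RankOne

/-! ### Transport of operators from `ℓ²(X)` to `L²(G, L²(G))` -/

section Transport

variable {G : Type*} [Group G] [MetricSpace G] [IsTopologicalGroup G] [ProperSpace G]
  [MeasurableSpace G] [BorelSpace G] {μ : Measure G} [μ.IsHaarMeasure]
  {X : Type*} {φ : X → Cbru G} (hφ : ∀ x, IsNormalized μ (φ x))
  (horth : ∀ x y, x ≠ y → star (φ x) * φ y = 0)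

theorem orthonormal_spreadIsometry (horth : ∀ x y, x ≠ y → star (φ x) * φ y = 0)
    {η : L2 μ ℂ} (hη : ‖η‖ = 1) :
    Orthonormal ℂ fun x => spreadIsometry (hφ x) η :=
  ⟨fun x => by rw [LinearIsometry.norm_map, hη],
    fun x y hxy => inner_spreadIsometry (hφ x) (hφ y) (horth x y hxy) η η⟩

/-- The isometry `ℓ²(X) → L²(G, L²(G))` that maps `δ_x` to `J_x η`, for a unit vector `η`. -/
def latticeIsometry {η : L2 μ ℂ} (hη : ‖η‖ = 1) : Ell2 X →ₗᵢ[ℂ] L2 μ (L2 μ ℂ) :=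
  (orthonormal_spreadIsometry hφ horth hη).orthogonalFamily.linearIsometry

theorem latticeIsometry_basisVec {η : L2 μ ℂ} (hη : ‖η‖ = 1) (x : X) :
    latticeIsometry hφ horth hη (basisVec x) = spreadIsometry (hφ x) η := by
  classical
  have h := (orthonormal_spreadIsometry hφ horth hη).orthogonalFamily.linearIsometry_apply_single
    (i := x) (1 : ℂ)
  rw [LinearIsometry.toSpanSingleton_apply, one_smul] at h
  rw [← h, latticeIsometry, basisVec]

theorem inner_latticeIsometry_eq_zero {η ζ : L2 μ ℂ} (hη : ‖η‖ = 1) (hζ : ‖ζ‖ = 1)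
    (hηζ : inner ℂ η ζ = 0) (u v : Ell2 X) :
    inner ℂ (latticeIsometry hφ horth hη u) (latticeIsometry hφ horth hζ v) = 0 := by
  let T : Ell2 X →L[ℂ] Ell2 X :=
    ContinuousLinearMap.adjoint (latticeIsometry hφ horth hη).toContinuousLinearMap ∘L
      (latticeIsometry hφ horth hζ).toContinuousLinearMap
  have hT : ∀ u v, inner ℂ u (T v)
      = inner ℂ (latticeIsometry hφ horth hη u) (latticeIsometry hφ horth hζ v) := fun u v => by
    rw [ContinuousLinearMap.comp_apply, ContinuousLinearMap.adjoint_inner_right]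
    rfl
  have h0 : ∀ y, T (basisVec y) = 0 := by
    intro y
    ext x
    rw [← inner_basisVec_left, hT, latticeIsometry_basisVec, latticeIsometry_basisVec]
    by_cases hxy : x = y
    · subst hxy
      rw [LinearIsometry.inner_map_map, hηζ]
      rfl
    · rw [inner_spreadIsometry (hφ x) (hφ y) (horth x y hxy)]
      rfl
  rw [← hT, clm_eq_sum_basisVec T ∅ (fun y _ => h0 y) v, Finset.sum_empty, inner_zero_right]

variable {ι : Type*} (e : HilbertBasis ι ℂ (L2 μ ℂ))

theorem orthogonalFamily_latticeIsometry :
    OrthogonalFamily ℂ (fun _ : ι => Ell2 X)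
      fun i => latticeIsometry hφ horth (e.orthonormal.1 i) :=
  fun _ _ hij u v => inner_latticeIsometry_eq_zero hφ horth _ _ (e.orthonormal.2 hij) u v

/-- The isometry `ℓ²(X) ⊗ L²(G) → L²(G, L²(G))`, `δ_x ⊗ η ↦ J_x η`; the tensor product is realised
as a Hilbert sum by means of an orthonormal basis of `L²(G)`. -/
def sumIsometry : lp (fun _ : ι => Ell2 X) 2 →ₗᵢ[ℂ] L2 μ (L2 μ ℂ) :=
  (orthogonalFamily_latticeIsometry hφ horth e).linearIsometry

theorem hasSum_sumIsometry (v : lp (fun _ : ι => Ell2 X) 2) :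
    HasSum (fun i => latticeIsometry hφ horth (e.orthonormal.1 i) (v i))
      (sumIsometry hφ horth e v) :=
  (orthogonalFamily_latticeIsometry hφ horth e).hasSum_linearIsometry v

open Classical in
theorem sumIsometry_single (i : ι) (v : Ell2 X) :
    sumIsometry hφ horth e (lp.single (E := fun _ : ι => Ell2 X) 2 i v)
      = latticeIsometry hφ horth (e.orthonormal.1 i) v :=
  (orthogonalFamily_latticeIsometry hφ horth e).linearIsometry_apply_single v

/-- The transport `T ↦ J (T ⊗ 1) J^*` of operators on `ℓ²(X)` to `L²(G, L²(G))`. -/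
def transport : (Ell2 X →L[ℂ] Ell2 X) →⋆ₙₐ[ℂ] (L2 μ (L2 μ ℂ) →L[ℂ] L2 μ (L2 μ ℂ)) :=
  (conjIsometry (sumIsometry hφ horth e)).comp (amplify ι)

theorem transport_apply (T : Ell2 X →L[ℂ] Ell2 X) (ξ : L2 μ (L2 μ ℂ)) :
    transport hφ horth e T ξ = sumIsometry hφ horth e (amplify (H := Ell2 X) ι T
      (ContinuousLinearMap.adjoint (sumIsometry hφ horth e).toContinuousLinearMap ξ)) := rfl

theorem compress_transport (i : ι) (T : Ell2 X →L[ℂ] Ell2 X) :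
    compress (latticeIsometry hφ horth (e.orthonormal.1 i)) (transport hφ horth e T) = T := by
  classical
  ext1 v
  rw [compress_apply, transport_apply, ← sumIsometry_single hφ horth e i v,
    adjoint_isometry_apply, amplify_single, sumIsometry_single, adjoint_isometry_apply]

theorem adjoint_sumIsometry_apply (ξ : L2 μ (L2 μ ℂ)) (i : ι) (x : X) :
    (ContinuousLinearMap.adjoint (sumIsometry hφ horth e).toContinuousLinearMap ξ) i x
      = inner ℂ (e i)
        (ContinuousLinearMap.adjoint (spreadIsometry (hφ x)).toContinuousLinearMap ξ) := by
  classical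
  rw [← inner_basisVec_left, ← lp.inner_single_left (G := fun _ : ι => Ell2 X),
    ContinuousLinearMap.adjoint_inner_right, ContinuousLinearMap.adjoint_inner_right]
  change inner ℂ (sumIsometry hφ horth e _) ξ = inner ℂ (spreadIsometry (hφ x) (e i)) ξ
  rw [sumIsometry_single, latticeIsometry_basisVec]

theorem apply_eq_sum_entry (a : Ell2 X →L[ℂ] Ell2 X) (x : X) (F : Finset X)
    (hF : ∀ y ∉ F, entry a x y = 0) (u : Ell2 X) : a u x = ∑ y ∈ F, u y * entry a x y := by
  have h := clm_eq_sum_basisVec ((innerSL ℂ (basisVec x)).comp a) F hF u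
  rw [← inner_basisVec_left x (a u)]
  exact h

/-- After a cutoff that only finitely many `φ_x` see, the transport of an operator with finite rows
is a finite combination of the products `J_x J_y^*`. -/
theorem mulOp_transport (k : Cbru G) (F F' : Finset X) (hF : ∀ x ∉ F, k * φ x = 0)
    (a : Ell2 X →L[ℂ] Ell2 X) (hF' : ∀ x ∈ F, ∀ y ∉ F', entry a x y = 0) (ξ : L2 μ (L2 μ ℂ)) :
    mulOp μ k (transport hφ horth e a ξ) = ∑ x ∈ F, ∑ y ∈ F', entry a x y •
      mulOp μ k (spreadIsometry (hφ x)
        (ContinuousLinearMap.adjoint (spreadIsometry (hφ y)).toContinuousLinearMap ξ)) := by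
  let ad : X → L2 μ ℂ := fun y =>
    ContinuousLinearMap.adjoint (spreadIsometry (hφ y)).toContinuousLinearMap ξ
  rw [transport_apply]
  have h1 := (mulOp μ k).hasSum (hasSum_sumIsometry hφ horth e (amplify (H := Ell2 X) ι a
    (ContinuousLinearMap.adjoint (sumIsometry hφ horth e).toContinuousLinearMap ξ)))
  have h2 : ∀ i, mulOp μ k (latticeIsometry hφ horth (e.orthonormal.1 i)
      (amplify (H := Ell2 X) ι a (ContinuousLinearMap.adjoint
        (sumIsometry hφ horth e).toContinuousLinearMap ξ) i))
      = ∑ x ∈ F, ∑ y ∈ F', entry a x y • mulOp μ k (spreadIsometry (hφ x)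
        (inner ℂ (e i) (ad y) • e i)) := by
    intro i
    have h3 := clm_eq_sum_basisVec
      ((mulOp μ k).comp (latticeIsometry hφ horth (e.orthonormal.1 i)).toContinuousLinearMap) F
      (fun x hx => by
        rw [ContinuousLinearMap.comp_apply]
        change mulOp μ k (latticeIsometry hφ horth (e.orthonormal.1 i) (basisVec x)) = 0
        rw [latticeIsometry_basisVec, mulOp_spreadIsometry (hφ x) (hF x hx)])
      (amplify (H := Ell2 X) ι a (ContinuousLinearMap.adjoint
        (sumIsometry hφ horth e).toContinuousLinearMap ξ) i)
    refine h3.trans (Finset.sum_congr rfl fun x hx => ?_)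
    rw [ContinuousLinearMap.comp_apply]
    change _ • mulOp μ k (latticeIsometry hφ horth (e.orthonormal.1 i) (basisVec x)) = _
    rw [latticeIsometry_basisVec, amplify_apply, apply_eq_sum_entry a x F' (hF' x hx),
      Finset.sum_smul]
    refine Finset.sum_congr rfl fun y _ => ?_
    rw [adjoint_sumIsometry_apply, map_smul, map_smul, smul_smul, mul_comm]
  simp only [h2] at h1
  refine h1.unique (hasSum_sum fun x _ => hasSum_sum fun y _ => ?_)
  have h4 := e.hasSum_repr (ad y)
  simp only [e.repr_apply_apply] at h4
  exact (((mulOp μ k).comp (spreadIsometry (hφ x)).toContinuousLinearMap).hasSum h4).const_smul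
    (entry a x y)

end Transport

/-! ### The transport takes values in the crossed product -/

section Crossed

variable {G : Type*} [Group G] [MetricSpace G] [IsTopologicalGroup G] [ProperSpace G]
  [MeasurableSpace G] [BorelSpace G] {μ : Measure G} [μ.IsHaarMeasure]
  {Z : Set G} {r κ : ℝ} (hsep : ∀ z w : Z, z ≠ w → 2 * r < dist (z : G) w)
  (hd : ∀ g x y : G, dist (g * x) (g * y) = dist x y) (hr : 0 ≤ r) (hκ : 0 ≤ κ)

theorem bumpCbru_apply (z y : G) :
    (bumpCbru hd hr hκ z : G →ᵇ ℂ) y = (bump r κ z y : ℂ) := rfl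

theorem star_bumpCbru (z : G) : star (bumpCbru hd hr hκ z) = bumpCbru hd hr hκ z := by
  ext y
  exact Complex.conj_ofReal _

include hsep in
theorem star_bumpCbru_mul (z w : Z) (hzw : z ≠ w) :
    star (bumpCbru hd hr hκ (z : G)) * bumpCbru hd hr hκ (w : G) = 0 := by
  rw [star_bumpCbru]
  ext y
  change (bump r κ (z : G) y : ℂ) * (bump r κ (w : G) y : ℂ) = 0
  by_contra h
  have h1 := dist_lt_of_bump_ne_zero (Complex.ofReal_ne_zero.1 (left_ne_zero_of_mul h))
  have h2 := dist_lt_of_bump_ne_zero (Complex.ofReal_ne_zero.1 (right_ne_zero_of_mul h))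
  have h3 := hsep z w hzw
  have h4 := dist_triangle (z : G) y w
  rw [dist_comm y] at h4
  linarith

/-- The element `s ↦ Δ(s)^{1/2} φ_z · R_s φ_w^*` of `C_c(G, C_b^{ru}(G))`, whose image under the
regular representation is a multiple of `J_z J_w^*`. -/
theorem exists_pairCc (z w : G) : ∃ f : C_c(G, Cbru G), ∀ s,
    f s = ((Real.sqrt (modular s) : ℝ) : ℂ) •
      (bumpCbru hd hr hκ z * (actionCbru G).act s (star (bumpCbru hd hr hκ w))) := by
  refine ⟨⟨⟨_, (by fun_prop : Continuous fun s : G => ((Real.sqrt (modular s) : ℝ) : ℂ)).smul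
    (continuous_const.mul ((actionCbru G).continuous_act (star (bumpCbru hd hr hκ w))))⟩,
    HasCompactSupport.intro (isCompact_closedBall (1 : G) (2 * r + dist z w)) fun s hs => ?_⟩,
    fun s => rfl⟩
  have h0 : bumpCbru hd hr hκ z * (actionCbru G).act s (star (bumpCbru hd hr hκ w)) = 0 := by
    rw [star_bumpCbru]
    ext y
    change (bump r κ z y : ℂ) * (bump r κ w (y * s) : ℂ) = 0
    by_contra h
    have h1 := dist_lt_of_bump_ne_zero (Complex.ofReal_ne_zero.1 (left_ne_zero_of_mul h))
    have h2 := dist_lt_of_bump_ne_zero (Complex.ofReal_ne_zero.1 (right_ne_zero_of_mul h))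
    rw [Metric.mem_closedBall, not_le, dist_comm s] at hs
    have h3 := dist_triangle4 y z w (y * s)
    rw [dist_mul_self_left hd, dist_comm y] at h3
    linarith
  change ((Real.sqrt (modular s) : ℝ) : ℂ) •
    (bumpCbru hd hr hκ z * (actionCbru G).act s (star (bumpCbru hd hr hκ w))) = 0
  rw [h0, smul_zero]

/-- Locally in `x`, the kernel of an operator of finite propagation is a finite sum of elementary
tensors. -/
theorem kern_eq_sum (a : Ell2 Z →L[ℂ] Ell2 Z) (x y : G) (F F' : Finset Z)
    (hF : ∀ z ∉ F, bump r κ (z : G) x = 0) (hF' : ∀ z ∈ F, ∀ w ∉ F', entry a z w = 0) :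
    kern hsep κ a x y = ∑ z ∈ F, ∑ w ∈ F', entry a z w *
      ((bump r κ (z : G) x : ℂ) * (bump r κ (w : G) y : ℂ)) := by
  have h1 : omega r κ hsep x = ∑ z ∈ F, (bump r κ (z : G) x : ℂ) • (basisVec z : Ell2 Z) :=
    (hasSum_basisVec _).unique (hasSum_sum_of_ne_finset_zero fun z hz => by
      rw [omega_apply, hF z hz, Complex.ofReal_zero, zero_smul])
  rw [kern, h1, sum_inner]
  refine Finset.sum_congr rfl fun z hz => ?_
  rw [inner_smul_left, inner_basisVec_left, apply_eq_sum_entry a z F' (hF' z hz), Finset.mul_sum,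
    Complex.conj_ofReal]
  refine Finset.sum_congr rfl fun w _ => ?_
  rw [omega_apply]
  ring

variable (hφ : ∀ z : Z, IsNormalized μ (bumpCbru hd hr hκ (z : G)))
  {ι : Type*} (e : HilbertBasis ι ℂ (L2 μ ℂ))

/-- The transport of an operator of finite propagation is a convolution element: after a cutoff both
sides are the same finite combination of products `J_z J_w^*`. -/
theorem transport_eq_smul_regularRep (hfin : ∀ ρ : ℝ, {z : Z | dist (1 : G) z ≤ ρ}.Finite)
    {a : Ell2 Z →L[ℂ] Ell2 Z} {R : ℝ} (ha : PropagationLE a R) :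
    transport hφ (star_bumpCbru_mul hsep hd hr hκ) e a
      = (invConst μ : ℂ) • regularRep μ (actionCbru G) (repCbru μ)
        (kernCc hsep hd hr hκ ha) := by
  ext1 ξ
  rw [← sub_eq_zero]
  refine eq_zero_of_mulOp_cutoff hd μ fun n => ?_
  rw [map_sub, sub_eq_zero]
  -- `F` contains the lattice points that the `n`-th cutoff sees, and `F'` those at distance at most
  -- `R` from them.
  let F : Finset Z := (hfin (n + 1 + r)).toFinset
  let F' : Finset Z := (hfin (n + 1 + r + R)).toFinset
  have hF' : ∀ z ∈ F, ∀ w ∉ F', entry a z w = 0 := by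
    intro z hz w hw
    by_contra h
    refine hw ?_
    have h1 : dist (1 : G) z ≤ n + 1 + r := by simpa [F] using hz
    have h2 : dist (z : G) w ≤ R := ha z w h
    have h3 := dist_triangle (1 : G) z w
    have h4 : dist (1 : G) w ≤ n + 1 + r + R := by linarith
    simpa [F'] using h4
  have hF0 : ∀ z ∉ F, ∀ x : G, dist 1 x < n + 1 → bump r κ (z : G) x = 0 := by
    intro z hz x hx
    by_contra h
    refine hz ?_
    have h1 := dist_lt_of_bump_ne_zero h
    have h2 := dist_triangle (1 : G) x z
    rw [dist_comm x] at h2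
    have h4 : dist (1 : G) z ≤ n + 1 + r := by linarith
    simpa [F] using h4
  have hF : ∀ z ∉ F, cutoff hd n * bumpCbru hd hr hκ (z : G) = 0 := by
    intro z hz
    ext x
    change (cutoff hd n : G →ᵇ ℂ) x * (bump r κ (z : G) x : ℂ) = 0
    rcases lt_or_ge (dist 1 x) ((n : ℝ) + 1) with hx | hx
    · rw [hF0 z hz x hx, Complex.ofReal_zero, mul_zero]
    · rw [cutoff_eq_zero hd hx, zero_mul]
  choose f hf using fun z w : Z => exists_pairCc hd hr hκ (z : G) w
  rw [mulOp_transport hφ _ e (cutoff hd n) F F' hF a hF' ξ]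
  let S : C_c(G, Cbru G) := ∑ z ∈ F, ∑ w ∈ F', entry a z w • f z w
  have hS : ∀ s, cutoff hd n * kernCc hsep hd hr hκ ha s = cutoff hd n * S s := by
    intro s
    ext x
    change (cutoff hd n : G →ᵇ ℂ) x * ((Real.sqrt (modular s) : ℂ) * kern hsep κ a x (x * s))
      = (cutoff hd n : G →ᵇ ℂ) x * (S s : G →ᵇ ℂ) x
    rcases lt_or_ge (dist 1 x) ((n : ℝ) + 1) with hx | hx
    · have h1 : (S s : G →ᵇ ℂ) x = ∑ z ∈ F, ∑ w ∈ F', entry a z w *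
          ((Real.sqrt (modular s) : ℂ) *
            ((bump r κ (z : G) x : ℂ) * (bump r κ (w : G) (x * s) : ℂ))) := by
        let ev : Cbru G →+ ℂ :=
          { toFun := fun h => (h : G →ᵇ ℂ) x, map_zero' := rfl, map_add' := fun _ _ => rfl }
        change ev (S s) = _
        simp only [S, CompactlySupportedContinuousMap.sum_apply, map_sum]
        refine Finset.sum_congr rfl fun z _ => Finset.sum_congr rfl fun w _ => ?_
        change ev (entry a z w • f z w s) = _
        rw [hf, star_bumpCbru]
        rfl
      rw [h1, kern_eq_sum hsep a x (x * s) F F' (fun z hz => hF0 z hz x hx) hF', Finset.mul_sum]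
      congr 1
      refine Finset.sum_congr rfl fun z _ => ?_
      rw [Finset.mul_sum]
      refine Finset.sum_congr rfl fun w _ => ?_
      ring
    · rw [cutoff_eq_zero hd hx, zero_mul, zero_mul]
  have hS2 : mulOp μ (cutoff hd n) (regularRep μ (actionCbru G) (repCbru μ)
      (kernCc hsep hd hr hκ ha) ξ)
      = mulOp μ (cutoff hd n) (regularRep μ (actionCbru G) (repCbru μ) S ξ) := by
    rw [mulOp, inducedRep_regularRep, inducedRep_regularRep]
    simp only [hS]
  have hS3 : (invConst μ : ℂ) • regularRep μ (actionCbru G) (repCbru μ) S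
      = ∑ z ∈ F, ∑ w ∈ F', entry a z w • ((spreadIsometry (hφ z)).toContinuousLinearMap ∘L
        ContinuousLinearMap.adjoint (spreadIsometry (hφ w)).toContinuousLinearMap) := by
    change (invConst μ : ℂ) • regularRepₗ μ (actionCbru G) (repCbru μ) S = _
    simp only [S, map_sum, map_smul, Finset.smul_sum]
    refine Finset.sum_congr rfl fun z _ => Finset.sum_congr rfl fun w _ => ?_
    rw [smul_comm]
    congr 1
    exact regularRep_eq_spread_mul_adjoint (hφ z) (hφ w) (f z w) (hf z w)
  rw [_root_.smul_apply, map_smul, hS2, ← map_smul, ← _root_.smul_apply, hS3]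
  simp only [_root_.sum_apply, map_sum, _root_.smul_apply, map_smul]
  rfl

end Crossed

/-! ### Images of the uniform Roe algebra and of the compact operators -/

section Rows

variable {X : Type*}

/-- The projection of `ℓ²(X)` onto the span of the `δ_x`, `x ∈ F`. -/
def projOn (F : Finset X) : Ell2 X →L[ℂ] Ell2 X :=
  ∑ x ∈ F, (innerSL ℂ (basisVec x)).smulRight (basisVec x)

theorem projOn_eq_sum (F : Finset X) (v : Ell2 X) :
    projOn F v = ∑ x ∈ F, v x • (basisVec x : Ell2 X) := by
  rw [projOn, _root_.sum_apply]
  refine Finset.sum_congr rfl fun x _ => ?_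
  rw [ContinuousLinearMap.smulRight_apply, innerSL_apply_apply, inner_basisVec_left]

theorem projOn_apply_of_mem {F : Finset X} {x : X} (hx : x ∈ F) (v : Ell2 X) :
    projOn F v x = v x := by
  rw [projOn_eq_sum, ← inner_basisVec_left, inner_sum, Finset.sum_eq_single x]
  · rw [inner_smul_right, inner_basisVec_left, basisVec_apply_self, mul_one]
  · intro y _ hy
    rw [inner_smul_right, inner_basisVec_left, basisVec_apply_ne hy.symm, mul_zero]
  · exact fun h => absurd hx h

theorem projOn_apply_of_notMem {F : Finset X} {x : X} (hx : x ∉ F) (v : Ell2 X) :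
    projOn F v x = 0 := by
  rw [projOn_eq_sum, ← inner_basisVec_left, inner_sum]
  refine Finset.sum_eq_zero fun y hy => ?_
  rw [inner_smul_right, inner_basisVec_left, basisVec_apply_ne, mul_zero]
  rintro rfl
  exact hx hy

theorem norm_projOn_apply_le (F : Finset X) (v : Ell2 X) : ‖projOn F v‖ ≤ ‖v‖ := by
  refine lp.norm_mono (by simp) fun x => ?_
  by_cases hx : x ∈ F
  · rw [projOn_apply_of_mem hx]
  · rw [projOn_apply_of_notMem hx, norm_zero]
    exact norm_nonneg _

theorem tendsto_projOn_apply (v : Ell2 X) :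
    Tendsto (fun F => projOn F v) atTop (𝓝 v) := by
  simp only [projOn_eq_sum]
  exact hasSum_basisVec v

/-- The projections `projOn F` converge to the identity strongly and with norm at most one, hence
uniformly on compact sets. -/
theorem exists_norm_projOn_mul_sub_le {T : Ell2 X →L[ℂ] Ell2 X} (hT : IsCompactOperator T)
    {ε : ℝ} (hε : 0 < ε) : ∃ F : Finset X, ‖projOn F * T - T‖ ≤ ε := by
  have hK := hT.isCompact_closure_image_closedBall 1
  obtain ⟨t, -, htf, ht⟩ := hK.finite_cover_balls (show 0 < ε / 3 by positivity)
  have h1 : ∀ᶠ F in atTop, ∀ y ∈ t, dist (projOn F y) y < ε / 3 :=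
    (htf.eventually_all).2 fun y _ =>
      (tendsto_projOn_apply y).eventually (Metric.ball_mem_nhds y (by positivity))
  obtain ⟨F, hF⟩ := h1.exists
  refine ⟨F, ContinuousLinearMap.opNorm_le_of_unit_norm hε.le fun v hv => ?_⟩
  have hmem : T v ∈ closure (T '' Metric.closedBall 0 1) :=
    subset_closure ⟨v, by simp [hv], rfl⟩
  obtain ⟨y, hy, hyv⟩ := Set.mem_iUnion₂.1 (ht hmem)
  rw [Metric.mem_ball, dist_eq_norm] at hyv
  have h2 := hF y hy
  rw [dist_eq_norm] at h2
  have h3 : (projOn F * T - T) v = projOn F (T v - y) + (projOn F y - y) - (T v - y) := by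
    rw [_root_.sub_apply, _root_.mul_apply_eq_comp, map_sub]
    abel
  rw [h3]
  refine (norm_sub_le _ _).trans ?_
  have h4 := norm_add_le (projOn F (T v - y)) (projOn F y - y)
  have h5 := norm_projOn_apply_le F (T v - y)
  linarith

theorem entry_projOn_mul_of_mem (a : Ell2 X →L[ℂ] Ell2 X) {F : Finset X} {x : X} (hx : x ∈ F)
    (y : X) : entry (projOn F * a) x y = entry a x y := by
  rw [entry_eq, entry_eq, _root_.mul_apply_eq_comp, projOn_apply_of_mem hx]

theorem entry_projOn_mul_of_notMem (a : Ell2 X →L[ℂ] Ell2 X) {F : Finset X} {x : X} (hx : x ∉ F)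
    (y : X) : entry (projOn F * a) x y = 0 := by
  rw [entry_eq, _root_.mul_apply_eq_comp, projOn_apply_of_notMem hx]

end Rows

section Image

variable {G : Type*} [Group G] [MetricSpace G] [IsTopologicalGroup G] [ProperSpace G]
  [MeasurableSpace G] [BorelSpace G] {μ : Measure G} [μ.IsHaarMeasure]

theorem regularRep_mem_crossedCbru (f : C_c(G, Cbru G)) :
    regularRep μ (actionCbru G) (repCbru μ) f ∈ crossedCbru μ :=
  NonUnitalStarSubalgebra.le_topologicalClosure _
    (NonUnitalStarAlgebra.subset_adjoin ℂ _ (Set.mem_range_self f))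

theorem regularRep_mem_crossedC0 (f : C_c(G, C₀(G, ℂ))) :
    regularRep μ (actionC0 G) (repC0 μ) f ∈ crossedC0 μ :=
  NonUnitalStarSubalgebra.le_topologicalClosure _
    (NonUnitalStarAlgebra.subset_adjoin ℂ _ (Set.mem_range_self f))

theorem isClosed_crossedC0 :
    IsClosed (crossedC0 μ : Set (L2 μ (L2 μ ℂ) →L[ℂ] L2 μ (L2 μ ℂ))) :=
  NonUnitalStarSubalgebra.isClosed_topologicalClosure _

theorem isClosed_crossedCbru :
    IsClosed (crossedCbru μ : Set (L2 μ (L2 μ ℂ) →L[ℂ] L2 μ (L2 μ ℂ))) :=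
  NonUnitalStarSubalgebra.isClosed_topologicalClosure _

/-- Every property that is closed and holds for operators of finite propagation holds on the
uniform Roe algebra. -/
theorem uniformRoeAlgebra_induction {X : Type*} [MetricSpace X]
    {p : (Ell2 X →L[ℂ] Ell2 X) → Prop}
    (hp : IsClosed {a | p a}) (h : ∀ a R, PropagationLE a R → p a) {T : Ell2 X →L[ℂ] Ell2 X}
    (hT : T ∈ uniformRoeAlgebra X) : p T := by
  have hT' : T ∈ closure (finitePropagation X : Set (Ell2 X →L[ℂ] Ell2 X)) := hT
  refine closure_minimal ?_ hp hT'
  rintro a ⟨R, -, ha⟩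
  exact h a R ha

variable {Z : Set G} {r κ : ℝ} (hsep : ∀ z w : Z, z ≠ w → 2 * r < dist (z : G) w)
  (hd : ∀ g x y : G, dist (g * x) (g * y) = dist x y) (hr : 0 ≤ r) (hκ : 0 ≤ κ)
  (hφ : ∀ z : Z, IsNormalized μ (bumpCbru hd hr hκ (z : G)))
  {ι : Type*} (e : HilbertBasis ι ℂ (L2 μ ℂ))

theorem transport_mem_crossedCbru (hfin : ∀ ρ : ℝ, {z : Z | dist (1 : G) z ≤ ρ}.Finite)
    {T : Ell2 Z →L[ℂ] Ell2 Z} (hT : T ∈ uniformRoeAlgebra Z) :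
    transport hφ (star_bumpCbru_mul hsep hd hr hκ) e T ∈ crossedCbru μ := by
  refine uniformRoeAlgebra_induction
    (p := fun a => transport hφ (star_bumpCbru_mul hsep hd hr hκ) e a ∈ crossedCbru μ)
    (isClosed_crossedCbru.preimage (map_continuous _)) (fun a R ha => ?_) hT
  rw [transport_eq_smul_regularRep hsep hd hr hκ hφ e hfin ha]
  exact SMulMemClass.smul_mem _ (regularRep_mem_crossedCbru _)

/-- The transport of an operator with finitely many non-zero rows: its coefficient functions are
supported near the corresponding lattice points. -/
theorem transport_mem_crossedC0_of_rows (hfin : ∀ ρ : ℝ, {z : Z | dist (1 : G) z ≤ ρ}.Finite)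
    {a : Ell2 Z →L[ℂ] Ell2 Z} {R : ℝ}
    (ha : PropagationLE a R) (F : Finset Z) (hF : ∀ z w, entry a z w ≠ 0 → z ∈ F) :
    transport hφ (star_bumpCbru_mul hsep hd hr hκ) e a ∈ crossedC0 μ := by
  obtain ⟨f, hf⟩ := exists_kernC0 hsep hd hr hκ ha F hF
  have h1 : regularRep μ (actionCbru G) (repCbru μ) (kernCc hsep hd hr hκ ha)
      = regularRep μ (actionC0 G) (repC0 μ) f := by
    ext1 ξ
    rw [regularRep_apply, regularRep_apply]
    simp only [← hf]
    rfl
  rw [transport_eq_smul_regularRep hsep hd hr hκ hφ e hfin ha, h1]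
  exact SMulMemClass.smul_mem _ (regularRep_mem_crossedC0 f)

/-- The transport of a compact operator in the uniform Roe algebra belongs to
`C_0(G) ⋊_{R,r} G` : the operator is the limit of its truncations to finitely many rows. -/
theorem transport_mem_crossedC0 (hfin : ∀ ρ : ℝ, {z : Z | dist (1 : G) z ≤ ρ}.Finite)
    {T : Ell2 Z →L[ℂ] Ell2 Z} (hT : T ∈ uniformRoeAlgebra Z) (hTc : IsCompactOperator T) :
    transport hφ (star_bumpCbru_mul hsep hd hr hκ) e T ∈ crossedC0 μ := by
  have hcont : Continuous (transport hφ (star_bumpCbru_mul hsep hd hr hκ) e) := map_continuous _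
  have h1 : ∀ F : Finset Z,
      transport hφ (star_bumpCbru_mul hsep hd hr hκ) e (projOn F * T) ∈ crossedC0 μ := by
    intro F
    refine uniformRoeAlgebra_induction
      (p := fun a => transport hφ (star_bumpCbru_mul hsep hd hr hκ) e (projOn F * a)
        ∈ crossedC0 μ)
      (isClosed_crossedC0.preimage (hcont.comp (continuous_const_mul _)))
      (fun a R ha => ?_) hT
    have hrow : ∀ z w, entry (projOn F * a) z w ≠ 0 → z ∈ F := fun z w h => by
      by_contra hz
      exact h (entry_projOn_mul_of_notMem a hz w)
    refine transport_mem_crossedC0_of_rows hsep hd hr hκ hφ e hfin (R := R) (fun z w h => ?_) F hrow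
    rw [entry_projOn_mul_of_mem a (hrow z w h)] at h
    exact ha z w h
  have h2 : T ∈ closure (Set.range fun F : Finset Z => projOn F * T) := by
    rw [Metric.mem_closure_iff]
    intro ε hε
    obtain ⟨F, hF⟩ := exists_norm_projOn_mul_sub_le hTc (half_pos hε)
    refine ⟨_, Set.mem_range_self F, ?_⟩
    rw [dist_comm, dist_eq_norm]
    linarith
  refine closure_minimal ?_ (isClosed_crossedC0.preimage hcont) h2
  rintro _ ⟨F, rfl⟩
  exact h1 F

end Image

/-! ### Compression of the crossed products to `ℓ²(Z)` -/

section Compression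

theorem isCompactOperator_of_basisVec_eq_zero {X : Type*} {E : Type*} [NormedAddCommGroup E]
    [NormedSpace ℂ E] (S : Ell2 X →L[ℂ] E) (F : Finset X) (h : ∀ x ∉ F, S (basisVec x) = 0) :
    IsCompactOperator S := by
  let A : (F → ℂ) →L[ℂ] E := ∑ x : F, (ContinuousLinearMap.proj x).smulRight (S (basisVec (x : X)))
  let B : Ell2 X →L[ℂ] (F → ℂ) := ContinuousLinearMap.pi fun x : F => innerSL ℂ (basisVec (x : X))
  have hAB : (S : Ell2 X → E) = A ∘ B := by
    funext v
    rw [clm_eq_sum_basisVec S F h v, ← Finset.sum_coe_sort F fun x => v x • S (basisVec x)]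
    simp only [A, B, Function.comp_apply, _root_.sum_apply]
    refine Finset.sum_congr rfl fun x _ => ?_
    rw [ContinuousLinearMap.smulRight_apply, ContinuousLinearMap.proj_apply,
      ContinuousLinearMap.pi_apply, innerSL_apply_apply, inner_basisVec_left]
  rw [hAB]
  exact (isCompactOperator_of_locallyCompactSpace_rng A).comp_clm B

variable {G : Type*} [Group G] [MetricSpace G] [IsTopologicalGroup G] [ProperSpace G]
  [MeasurableSpace G] [BorelSpace G] {μ : Measure G} [μ.IsHaarMeasure]
  {Z : Set G} {r κ : ℝ} (hsep : ∀ z w : Z, z ≠ w → 2 * r < dist (z : G) w)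
  (hd : ∀ g x y : G, dist (g * x) (g * y) = dist x y) (hr : 0 ≤ r) (hκ : 0 ≤ κ)

/-- A function in `C_b^{ru}(G)` that is `1` on the ball of radius `r` around `z` and `0` outside the
ball of radius `r + 1`. -/
def plateau (hd : ∀ g x y : G, dist (g * x) (g * y) = dist x y) (r : ℝ) (z : G) : Cbru G :=
  truncCbru hd (fun x => r + 1 - dist z x) fun x y => by
    have h := abs_dist_sub_le x y z
    rw [dist_comm x z, dist_comm y z, abs_sub_comm] at h
    calc _ = |dist z y - dist z x| := by congr 1; ring
      _ ≤ _ := h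

theorem plateau_mul_bumpCbru (z : G) :
    plateau hd r z * bumpCbru hd hr hκ z = bumpCbru hd hr hκ z := by
  ext x
  change (plateau hd r z : G →ᵇ ℂ) x * (bump r κ z x : ℂ) = (bump r κ z x : ℂ)
  rcases lt_or_ge (dist z x) r with h | h
  · rw [plateau, truncCbru_eq_one hd _ _ (by linarith), one_mul]
  · rw [bump_eq_zero h, Complex.ofReal_zero, mul_zero]

theorem dist_lt_of_plateau_ne_zero {z x : G} (h : (plateau hd r z : G →ᵇ ℂ) x ≠ 0) :
    dist z x < r + 1 := by
  by_contra hcon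
  exact h (truncCbru_eq_zero hd _ _ (by linarith))

variable (hφ : ∀ z : Z, IsNormalized μ (bumpCbru hd hr hκ (z : G))) {η : L2 μ ℂ} (hη : ‖η‖ = 1)

theorem entry_compress (b : L2 μ (L2 μ ℂ) →L[ℂ] L2 μ (L2 μ ℂ)) (z w : Z) :
    entry (compress (latticeIsometry hφ (star_bumpCbru_mul hsep hd hr hκ) hη) b) z w
      = inner ℂ (spreadIsometry (hφ z) η) (b (spreadIsometry (hφ w) η)) := by
  rw [entry, inner_compress, latticeIsometry_basisVec, latticeIsometry_basisVec]

/-- The vectors `J_z η` are localised near `z` by the plateau functions, so that compression does not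
destroy finite propagation. -/
theorem propagationLE_compress {b : L2 μ (L2 μ ℂ) →L[ℂ] L2 μ (L2 μ ℂ)} {R : ℝ}
    (hb : HasPropagation μ b R) :
    PropagationLE (compress (latticeIsometry hφ (star_bumpCbru_mul hsep hd hr hκ) hη) b)
      (R + 2 * (r + 1)) := by
  intro z w h
  by_contra hzw
  rw [not_le] at hzw
  refine h ?_
  have h1 : mulOp μ (plateau hd r (z : G)) * b * mulOp μ (plateau hd r (w : G)) = 0 := by
    refine hb _ _ fun x y hx hy => ?_
    have hx' := dist_lt_of_plateau_ne_zero hd hx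
    have hy' := dist_lt_of_plateau_ne_zero hd hy
    have h2 := dist_triangle4 (z : G) x y w
    rw [dist_comm y] at h2
    change R + 2 * (r + 1) < dist (z : G) w at hzw
    linarith
  have h2 : star (mulOp μ (plateau hd r (z : G))) = mulOp μ (plateau hd r (z : G)) := by
    rw [mulOp, ← inducedRep_star, plateau, star_truncCbru]
  rw [entry_compress hsep, ← mulOp_spreadIsometry_self (hφ z) (plateau_mul_bumpCbru hd hr hκ (z : G)) η,
    ← mulOp_spreadIsometry_self (hφ w) (plateau_mul_bumpCbru hd hr hκ (w : G)) η, ← h2,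
    ContinuousLinearMap.star_eq_adjoint, ContinuousLinearMap.adjoint_inner_left]
  change inner ℂ _ ((mulOp μ (plateau hd r (z : G)) * b * mulOp μ (plateau hd r (w : G))) _) = 0
  rw [h1, _root_.zero_apply, inner_zero_right]

theorem compress_mem_uniformRoeAlgebra {b : L2 μ (L2 μ ℂ) →L[ℂ] L2 μ (L2 μ ℂ)}
    (hb : b ∈ crossedCbru μ) :
    compress (latticeIsometry hφ (star_bumpCbru_mul hsep hd hr hκ) hη) b
      ∈ uniformRoeAlgebra Z := by
  have hb' : b ∈ closure (NonUnitalStarAlgebra.adjoin ℂ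
      (Set.range (regularRep μ (actionCbru G) (repCbru μ))) : Set _) := hb
  have h := map_mem_closure (t := (finitePropagation Z : Set (Ell2 Z →L[ℂ] Ell2 Z)))
    (continuous_compress (latticeIsometry hφ (star_bumpCbru_mul hsep hd hr hκ) hη)) hb'
    fun a ha => ?_
  · exact h
  obtain ⟨R, hR⟩ := adjoin_le_finProp hd μ ha
  exact ⟨|R| + 2 * (r + 1), by positivity,
    propagationLE_compress hsep hd hr hκ hφ hη (hR.mono (le_abs_self R))⟩

/-- The compression of an operator on which the cutoff functions act as an approximate unit is
compact: after a cutoff it only sees finitely many basis vectors. -/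
theorem isCompactOperator_compress (hfin : ∀ ρ : ℝ, {z : Z | dist (1 : G) z ≤ ρ}.Finite)
    {b : L2 μ (L2 μ ℂ) →L[ℂ] L2 μ (L2 μ ℂ)} (hb : b ∈ decaying hd μ) :
    IsCompactOperator
      (compress (latticeIsometry hφ (star_bumpCbru_mul hsep hd hr hκ) hη) b) := by
  refine isCompactOperator_of_tendsto (((continuous_compress
    (latticeIsometry hφ (star_bumpCbru_mul hsep hd hr hκ) hη)).tendsto b).comp hb.1)
    (Eventually.of_forall fun n => ?_)
  refine isCompactOperator_of_basisVec_eq_zero _ (hfin (n + 1 + r)).toFinset fun z hz => ?_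
  have hz' : (n : ℝ) + 1 + r < dist (1 : G) z := by simpa using hz
  have h1 : cutoff hd n * bumpCbru hd hr hκ (z : G) = 0 := by
    ext x
    change (cutoff hd n : G →ᵇ ℂ) x * (bump r κ (z : G) x : ℂ) = 0
    rcases lt_or_ge (dist 1 x) ((n : ℝ) + 1) with hx | hx
    · have h2 := dist_triangle (1 : G) x z
      rw [dist_comm x] at h2
      rw [bump_eq_zero (by linarith), Complex.ofReal_zero, mul_zero]
    · rw [cutoff_eq_zero hd hx, zero_mul]
  rw [Function.comp_apply, compress_apply, latticeIsometry_basisVec, _root_.mul_apply_eq_comp,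
    mulOp_spreadIsometry (hφ z) h1, map_zero, map_zero]

end Compression

section Normalization

variable {G : Type*} [Group G] [MetricSpace G] [IsTopologicalGroup G] [ProperSpace G]
  [MeasurableSpace G] [BorelSpace G] (μ : Measure G) [μ.IsHaarMeasure]

/-- By left invariance all the functions `bump r κ z` have the same `L²`-norm, which scales with
`κ`. -/
theorem exists_isNormalized_bumpCbru (hd : ∀ g x y : G, dist (g * x) (g * y) = dist x y) {r : ℝ}
    (hr : 0 < r) : ∃ (κ : ℝ) (hκ : 0 ≤ κ), ∀ z : G, IsNormalized μ (bumpCbru hd hr.le hκ z) := by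
  let I : ℝ := ∫ y, bump r 1 (1 : G) y ^ 2 ∂μ
  have hcont : Continuous fun y : G => bump r 1 (1 : G) y ^ 2 := (continuous_bump 1).pow 2
  have hsupp : HasCompactSupport fun y : G => bump r 1 (1 : G) y ^ 2 :=
    HasCompactSupport.intro (isCompact_closedBall (1 : G) r) fun y hy => by
      rw [Metric.mem_closedBall, not_le, dist_comm] at hy
      rw [bump_eq_zero hy.le, zero_pow two_ne_zero]
  have hI : 0 < I := by
    refine hcont.integral_pos_of_hasCompactSupport_nonneg_nonzero hsupp (fun y => sq_nonneg _)
      (x := 1) ?_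
    rw [bump, dist_self, sub_zero, max_eq_right hr.le, one_mul]
    positivity
  have hc := invConst_pos μ
  let κ : ℝ := (Real.sqrt (invConst μ * I))⁻¹
  have hκ : 0 ≤ κ := by positivity
  refine ⟨κ, hκ, fun z => ?_⟩
  have h1 : ∀ y, ‖(bumpCbru hd hr.le hκ z : G →ᵇ ℂ) y‖ₑ ^ 2
      = ENNReal.ofReal (κ ^ 2) * ENNReal.ofReal (bump r 1 (1 : G) (z⁻¹ * y) ^ 2) := by
    intro y
    rw [bumpCbru_apply, bump_mul_left hd z y, ← ENNReal.ofReal_mul (sq_nonneg κ), ← ofReal_norm,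
      ← ENNReal.ofReal_pow (norm_nonneg _), Complex.norm_real, Real.norm_eq_abs, sq_abs, bump,
      bump]
    congr 1
    ring
  rw [IsNormalized, lintegral_congr h1, lintegral_const_mul' _ _ ENNReal.ofReal_ne_top,
    lintegral_mul_left_eq_self (fun y => ENNReal.ofReal (bump r 1 (1 : G) y ^ 2)) z⁻¹,
    ← ofReal_integral_eq_lintegral_ofReal (hcont.integrable_of_hasCompactSupport hsupp)
      (Eventually.of_forall fun y => sq_nonneg _),
    ← ENNReal.ofReal_mul (sq_nonneg κ), ← ENNReal.ofReal_mul hc.le, inv_pow,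
    Real.sq_sqrt (by positivity)]
  change ENNReal.ofReal (invConst μ * ((invConst μ * I)⁻¹ * I)) = 1
  rw [ENNReal.ofReal_eq_one]
  field_simp

theorem nontrivial_L2 : Nontrivial (L2 μ ℂ) := by
  by_contra h
  rw [not_nontrivial_iff_subsingleton] at h
  have h1 : (1 : G →ᵇ ℂ) = 0 := mulRep_injective μ (by ext1 ξ; exact Subsingleton.elim _ _)
  exact one_ne_zero (DFunLike.congr_fun h1 (1 : G))

theorem nonempty_of_hilbertBasis {ι H : Type*} [NormedAddCommGroup H] [InnerProductSpace ℂ H]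
    [Nontrivial H] (e : HilbertBasis ι ℂ H) : Nonempty ι := by
  by_contra h
  rw [not_nonempty_iff] at h
  obtain ⟨x, y, hxy⟩ := exists_pair_ne H
  refine hxy (e.repr.injective ?_)
  ext i
  exact isEmptyElim i

theorem UniformlyLocallyFinite.finite_setOf_dist_le {Z : Set G} (hZ : UniformlyLocallyFinite Z)
    (x : G) (ρ : ℝ) : {z : Z | dist x z ≤ ρ}.Finite := by
  rcases Set.eq_empty_or_nonempty {z : Z | dist x z ≤ ρ} with h | ⟨w, hw⟩
  · rw [h]
    exact Set.finite_empty
  obtain ⟨N, hN⟩ := hZ (2 * |ρ| + 1) (by positivity)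
  refine (Set.finite_of_encard_le_coe (hN w)).subset fun z hz => ?_
  have h1 : dist x z ≤ ρ := hz
  have h2 : dist x w ≤ ρ := hw
  have h3 := dist_triangle (z : G) x w
  rw [dist_comm (z : G) x] at h3
  have h4 := le_abs_self ρ
  change dist (z : G) w ≤ 2 * |ρ| + 1
  linarith

end Normalization

end RoeCrossed

end

theorem mainTheorem6 {G : Type*} [Group G] [MetricSpace G] [IsTopologicalGroup G]
    [ProperSpace G] [MeasurableSpace G] [BorelSpace G]
    (hd : ∀ g x y : G, dist (g * x) (g * y) = dist x y)
    (μ : Measure G) [μ.IsHaarMeasure]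
    (Z : Set G) (hZ : IsMetricLattice Z) (hZ' : UniformlyLocallyFinite Z) :
    ∃ (Φ : uniformRoeAlgebra Z →⋆ₙₐ[ℂ] crossedCbru μ)
      (E : crossedCbru μ →ₗ[ℂ] uniformRoeAlgebra Z),
      Function.Injective Φ ∧ IsCCP E ∧
      (∀ T : uniformRoeAlgebra Z, E (Φ T) = T) ∧
      ∀ T : uniformRoeAlgebra Z,
        IsCompactOperator (T : Ell2 Z →L[ℂ] Ell2 Z) ↔
          (Φ T : L2 μ (L2 μ ℂ) →L[ℂ] L2 μ (L2 μ ℂ)) ∈ crossedC0 μ := by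
  -- The radius `δ / 2` makes the supports of the bump functions disjoint.
  obtain ⟨⟨δ, hδ, hsep⟩, -⟩ := hZ
  have hsep' : ∀ z w : Z, z ≠ w → 2 * (δ / 2) < dist (z : G) w := fun z w hzw => by
    rw [mul_div_cancel₀ δ two_ne_zero]
    exact hsep z w hzw
  have hfin : ∀ ρ : ℝ, {z : Z | dist (1 : G) z ≤ ρ}.Finite := hZ'.finite_setOf_dist_le 1
  have hr : 0 < δ / 2 := half_pos hδ
  obtain ⟨κ, hκ, hφ⟩ := exists_isNormalized_bumpCbru μ hd hr
  have hφ' : ∀ z : Z, IsNormalized μ (bumpCbru hd hr.le hκ (z : G)) := fun z => hφ z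
  have hnt := nontrivial_L2 μ
  obtain ⟨s, e, -⟩ := exists_hilbertBasis ℂ (L2 μ ℂ)
  obtain ⟨i⟩ := nonempty_of_hilbertBasis e
  -- `W` embeds `ℓ²(Z)` as the summand `ℓ²(Z) ⊗ e i`, on which `T ⊗ 1` acts as `T`.
  let τ := transport hφ' (star_bumpCbru_mul hsep' hd hr.le hκ) e
  let W := latticeIsometry hφ' (star_bumpCbru_mul hsep' hd hr.le hκ) (e.orthonormal.1 i)
  have hτ : ∀ T, compress W (τ T) = T := compress_transport hφ' _ e i
  obtain ⟨Φ, E, hinj, hE, hEΦ, hΦ⟩ := exists_starHom_and_isCCP (crossedCbru μ)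
    (uniformRoeAlgebra Z) W τ hτ
    (fun T hT => transport_mem_crossedCbru hsep' hd hr.le hκ hφ' e hfin hT)
    (fun b hb => compress_mem_uniformRoeAlgebra hsep' hd hr.le hκ hφ' (e.orthonormal.1 i) hb)
  refine ⟨Φ, E, hinj, hE, hEΦ, fun T => ⟨fun hT => ?_, fun hT => ?_⟩⟩
  · rw [hΦ]
    exact transport_mem_crossedC0 hsep' hd hr.le hκ hφ' e hfin T.2 hT
  · rw [hΦ] at hT
    rw [← hτ (T : Ell2 Z →L[ℂ] Ell2 Z)]
    exact isCompactOperator_compress hsep' hd hr.le hκ hφ' (e.orthonormal.1 i) hfin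
      (crossedC0_le_decaying hd μ hT)
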